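/- All graphs and hypergraphs are finite. Graphs $G_1,\dots,G_m$ are *nearly disjoint* if $|V(G_i)\cap V(G_j)|\le 1$ for all distinct $i,j$. A *correspondence assignment* $(L,M)$ for a graph $G$ assigns to each vertex $v$ a finite set $L(v)$ of colors and to each edge $uv$ a (not necessarily perfect) matching $M(uv)$ between $\{u\}\times L(u)$ and $\{v\}\times L(v)$. The graph $G$ is *$(L,M)$-colorable* if there is a map $\phi$ on $V(G)$ with $\phi(v)\in L(v)$ for every vertex $v$ and $(u,\phi(u))(v,\phi(v))\notin M(uv)$ for every edge $uv$. The *color degree* of $v\in V(G)$ and $c\in L(v)$ is the number of pairs $(u,c')$ with $uv\in E(G)$ and $(v,c)(u,c')\in M(uv)$, and $\Delta(G,(L,M))$ is the maximum of the color degrees over all $v\in V(G)$ and $c\in L(v)$. **Theorem.** For every $C,\varepsilon>0$ there is $D_0=D_0(C,\varepsilon)$ such that the following holds for every real $D\ge D_0$. Let $G_1,\dots,G_m$ be graphs that 1. are nearly disjoint, and 2. satisfy $|\{i : v\in V(G_i)\}|\le C$ for every $v\in\bigcup_{i=1}^m V(G_i)$. If $(L,M)$ is a correspondence assignment for $G:=\bigcup_{i=1}^m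 G_i$ such that 3. $\Delta(G_i,(L|_{V(G_i)},M|_{E(G_i)}))\le D$ for every $i$, and 4. $|L(v)|\ge(1+\varepsilon)D$ for every $v\in V(G)$, then $G$ is $(L,M)$-colorable. In particular, for every $k\in\mathbb N$ and $\varepsilon>0$ there is $D_0=D_0(k,\varepsilon)$ such that for every real $D\ge D_0$, every linear hypergraph (any two distinct edges share at most one vertex) whose edges all have size at most $k$ and in which every vertex lies in at most $D$ edges has correspondence chromatic index at most $(1+\varepsilon)D$. Here the correspondence chromatic index of a hypergraph is the least $j$ such that its line graph (whose vertices are the edges of the hypergraph, two distinct ones being adjacent if they intersect) is $(L,M)$-colorable for every correspondence assignment $(L,M)$ with $|L(e)|\ge j$ for all $e$. -/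

import Mathlib

/-! A graph whose vertices lie in an ambient type `V` is a term of
`(⊤ : SimpleGraph V).Subgraph`: a vertex set `verts : Set V` with a symmetric irreflexive adjacency
relation on it. The union of a family of graphs is the supremum `⨆ i, G i`, whose vertex set and
edge set are the unions of the vertex sets and of the edge sets. -/

namespace DPColoring

/-- Graphs on vertices from `V`, each with its own vertex set. -/
abbrev Gr (V : Type*) := (⊤ : SimpleGraph V).Subgraph

/-- Any two of the graphs have at most one vertex in common. -/
def NearlyDisjoint {V ι : Type*} (G : ι → Gr V) : Prop :=
  ∀ i j, i ≠ j → ((G i).verts ∩ (G j).verts).encard ≤ 1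

/-- `(L, M)` is a correspondence assignment for `G`. Here `M u v c c'` says that the pair
`(u, c)(v, c')` belongs to `M(uv)`; for every edge `uv` of `G` these pairs form a matching between
`{u} × L(u)` and `{v} × L(v)`. The values of `L` outside `V(G)` and of `M` outside `E(G)` play no
role, so that the restriction of `(L, M)` to a subgraph of `G` is given by the same `L` and `M`. -/
structure IsCorrespondenceAssignment {V α : Type*} (G : Gr V) (L : V → Finset α)
    (M : V → V → α → α → Prop) : Prop where
  /-- `M(uv)` depends only on the unordered edge `uv`. -/
  symm : ∀ u v, G.Adj u v → ∀ c c', M u v c c' ↔ M v u c' c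
  /-- The pairs in `M(uv)` join `{u} × L(u)` to `{v} × L(v)`. -/
  mem : ∀ u v, G.Adj u v → ∀ c c', M u v c c' → c ∈ L u ∧ c' ∈ L v
  /-- `(u, c)` lies in at most one pair of `M(uv)`; with `symm` the same holds for `(v, c')`. -/
  matching : ∀ u v, G.Adj u v → ∀ c c₁ c₂, M u v c c₁ → M u v c c₂ → c₁ = c₂

/-- `φ` is an `(L, M)`-coloring of `G`. -/
def IsColoring {V α : Type*} (G : Gr V) (L : V → Finset α) (M : V → V → α → α → Prop)
    (φ : G.verts → α) : Prop :=
  (∀ u : G.verts, φ u ∈ L u) ∧ ∀ u v : G.verts, G.Adj u v → ¬ M u v (φ u) (φ v)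

/-- `G` is `(L, M)`-colorable. -/
def IsColorable {V α : Type*} (G : Gr V) (L : V → Finset α) (M : V → V → α → α → Prop) : Prop :=
  ∃ φ : G.verts → α, IsColoring G L M φ

/-- The set `N(v, c)` of all `(u, c')` with `uv` an edge of `G` and `cc'` in `M(vu)`. -/
def colorNeighbors {V α : Type*} (G : Gr V) (M : V → V → α → α → Prop) (v : V) (c : α) :
    Set (V × α) :=
  {p | G.Adj v p.1 ∧ M v p.1 c p.2}

/-- The color degree of `v` and `c`. -/
noncomputable def colorDegree {V α : Type*} (G : Gr V) (M : V → V → α → α → Prop) (v : V) (c : α) :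
    ℕ :=
  (colorNeighbors G M v c).ncard

/-- The maximum color degree: the largest color degree of a vertex `v` and a color `c ∈ L(v)`
(zero if there is no such pair). It is used for finite graphs only. -/
noncomputable def maxColorDegree {V α : Type*} (G : Gr V) (L : V → Finset α)
    (M : V → V → α → α → Prop) : ℕ :=
  sSup {d | ∃ v ∈ G.verts, ∃ c ∈ L v, d = colorDegree G M v c}

/-- The correspondence chromatic number: the least `k` such that `G` is `(L, M)`-colorable for every
correspondence assignment with all lists of size at least `k`. The colors may be taken to be natural
numbers, because the colors in the list of each single vertex can be renamed injectively, together
with the matchings at that vertex, without affecting colorability. -/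
noncomputable def chiDP {V : Type*} (G : Gr V) : ℕ∞ :=
  ⨅ k ∈ {k : ℕ | ∀ (L : V → Finset ℕ) (M : V → V → ℕ → ℕ → Prop),
    IsCorrespondenceAssignment G L M → (∀ v ∈ G.verts, k ≤ (L v).card) → IsColorable G L M},
    (k : ℕ∞)

/-- The line graph of a hypergraph: its vertices are the edges of the hypergraph, and two distinct
edges are adjacent if they have a vertex in common. -/
def lineGraph {W : Type*} (H : Hypergraph W) : Gr (Set W) where
  verts := H.edgeSet
  Adj e f := H.EAdj e f ∧ e ≠ f
  adj_sub h := h.2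
  edge_vert h := h.1.1
  symm := ⟨fun _ _ h => ⟨h.1.symm, h.2.symm⟩⟩

/-- Any two distinct edges of the hypergraph meet in at most one vertex. -/
def IsLinear {W : Type*} (H : Hypergraph W) : Prop :=
  ∀ e ∈ H.edgeSet, ∀ f ∈ H.edgeSet, e ≠ f → (e ∩ f).encard ≤ 1

/-- Every edge of the hypergraph has at most `k` vertices. -/
def IsBounded {W : Type*} (k : ℕ) (H : Hypergraph W) : Prop :=
  ∀ e ∈ H.edgeSet, e.encard ≤ k

/-- The degree of `x` in the hypergraph: the number of edges that contain `x`. -/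
noncomputable def hyperDegree {W : Type*} (H : Hypergraph W) (x : W) : ℕ :=
  {e | e ∈ H.edgeSet ∧ x ∈ e}.ncard

/-- The correspondence chromatic index of a hypergraph. -/
noncomputable def indexDP {W : Type*} (H : Hypergraph W) : ℕ∞ :=
  chiDP (lineGraph H)

end DPColoring

/-! The proof is a semi-random coloring in rounds. After trimming, every vertex has exactly `l`
colors and every color has at most `d` conflicts in each graph through its vertex, with `d ≤ s * l`
for some fixed `s < 1`. A round lowers the ratio `d / l` by a constant factor. Once the ratio is at
most `1 / (16 * C)`, the local lemma applied to uniform random colors finishes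
(`IsCover.colorable_of_mul_le`).

In a round, each vertex independently receives a tentative color with a small probability `p`,
uniformly among its `l` colors. Every color in conflict with a tentative color is deleted, whether
or not that tentative color is kept, and an independent coin flip equalizes the survival
probabilities. A tentative color is kept unless it conflicts with that of an earlier vertex in a
fixed linear order. Put `Q = (1 - p / l) ^ d`. A color survives with probability exactly `Q ^ C`, so
lists shrink by about this factor. A conflict in a given graph `i` survives only if its vertex stays
uncolored and its color survives the conflicts outside graph `i`, which for a vertex without
tentative color has probability at most `(1 - p) * Q ^ (C - 1)`. Since `Q ≥ 1 - p * s > 1 - p`,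
degrees shrink faster than lists (`degree_ratio_le`).

Conflicts inside graph `i` are ignored in the degree count because one tentative color there may
affect many members of a neighborhood. Outside graph `i`, near disjointness limits its effect to a
constant (`IsCover.card_outerNbr_forbid_le`), so the count concentrates (`prob_avoidCount_le`).
Vertices that lose their tentative color contribute only order `p ^ 2`; the linear order makes these
losses a sum with small conditional probabilities, whose upper tail is bounded by
`expect_exp_sum_le_of_ordered`. The failure probabilities are exponentially small in `l` while each
bad event meets polynomially many others, so the local lemma yields a good round
(`IsCover.exists_round`). The number of rounds depends only on `C` and `s`.

For hypergraphs, the line graph is a union of cliques, one per hypergraph vertex; linearity makes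
them nearly disjoint, and the edge size bounds the number of cliques through a line graph vertex. -/

namespace DPColoring

open Finset Function

/-! ### Independent random variables on a finite product space. -/

section Expectation

variable {I β : Type*} [Fintype I] [Fintype β]

/-- A family of probability distributions on the finite set `β`, indexed by `I`. -/
structure IsProbFamily (μ : I → β → ℝ) : Prop where
  nonneg : ∀ i x, 0 ≤ μ i x
  sum_one : ∀ i, ∑ x, μ i x = 1

variable [DecidableEq I]

/-- The expectation of `f` when the coordinates are independent with distributions `μ i`. -/
noncomputable def expect (μ : I → β → ℝ) (f : (I → β) → ℝ) : ℝ :=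
  ∑ ω, (∏ i, μ i (ω i)) * f ω

/-- The probability of an event in the product space. -/
noncomputable def prob (μ : I → β → ℝ) (A : Set (I → β)) : ℝ :=
  expect μ (A.indicator 1)

variable {μ : I → β → ℝ}

lemma expect_prod (h : I → β → ℝ) :
    expect μ (fun ω => ∏ i, h i (ω i)) = ∏ i, ∑ x, μ i x * h i x := by
  simp only [expect, ← Finset.prod_mul_distrib]
  rw [Finset.prod_univ_sum, Fintype.piFinset_univ]

lemma expect_add (f g : (I → β) → ℝ) :
    expect μ (fun ω => f ω + g ω) = expect μ f + expect μ g := by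
  simp [expect, mul_add, Finset.sum_add_distrib]

lemma expect_neg (f : (I → β) → ℝ) : expect μ (fun ω => - f ω) = - expect μ f := by
  simp [expect]

lemma expect_const_mul (c : ℝ) (f : (I → β) → ℝ) :
    expect μ (fun ω => c * f ω) = c * expect μ f := by
  simp only [expect, Finset.mul_sum]
  exact Finset.sum_congr rfl fun _ _ => by ring

lemma expect_mul_const (c : ℝ) (f : (I → β) → ℝ) :
    expect μ (fun ω => f ω * c) = expect μ f * c := by
  simp only [expect, Finset.sum_mul]
  exact Finset.sum_congr rfl fun _ _ => by ring

lemma expect_sum {A : Type*} (s : Finset A) (f : A → (I → β) → ℝ) :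
    expect μ (fun ω => ∑ a ∈ s, f a ω) = ∑ a ∈ s, expect μ (f a) := by
  simp only [expect, Finset.mul_sum]
  exact Finset.sum_comm

namespace IsProbFamily

variable (hμ : IsProbFamily μ)
include hμ

omit [DecidableEq I] in
lemma weight_nonneg (ω : I → β) : 0 ≤ ∏ i, μ i (ω i) :=
  Finset.prod_nonneg fun _ _ => hμ.nonneg _ _

lemma expect_mono {f g : (I → β) → ℝ} (h : ∀ ω, f ω ≤ g ω) : expect μ f ≤ expect μ g :=
  Finset.sum_le_sum fun ω _ => mul_le_mul_of_nonneg_left (h ω) (hμ.weight_nonneg ω)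

lemma expect_nonneg {f : (I → β) → ℝ} (h : ∀ ω, 0 ≤ f ω) : 0 ≤ expect μ f :=
  Finset.sum_nonneg fun ω _ => mul_nonneg (hμ.weight_nonneg ω) (h ω)

lemma expect_const (c : ℝ) : expect μ (fun _ => c) = c := by
  have := expect_prod (μ := μ) (fun _ _ => 1)
  simp only [Finset.prod_const_one, mul_one, hμ.sum_one] at this
  have h2 := expect_const_mul (μ := μ) c (fun _ => 1)
  simpa [this] using h2

lemma expect_eval (i : I) (h : β → ℝ) :
    expect μ (fun ω => h (ω i)) = ∑ x, μ i x * h x := by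
  have := expect_prod (μ := μ) (fun j x => if j = i then h x else 1)
  have e : ∀ ω : I → β, (∏ j, if j = i then h (ω j) else 1) = h (ω i) := fun ω => by
    rw [Finset.prod_eq_single i] <;> simp +contextual
  simp only [e] at this
  rw [this, Finset.prod_eq_single i]
  · simp
  · intro j _ hj
    simp [hj, hμ.sum_one]
  · simp

lemma prob_nonneg (A : Set (I → β)) : 0 ≤ prob μ A :=
  hμ.expect_nonneg fun ω => Set.indicator_nonneg (fun _ _ => zero_le_one) ω

lemma prob_mono {A B : Set (I → β)} (h : A ⊆ B) : prob μ A ≤ prob μ B :=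
  hμ.expect_mono fun ω => Set.indicator_le_indicator_of_subset h (fun _ => zero_le_one) ω

lemma prob_univ : prob μ Set.univ = 1 := by
  rw [prob, Set.indicator_univ]
  exact hμ.expect_const 1

omit hμ in
lemma prob_empty : prob μ (∅ : Set (I → β)) = 0 := by
  simp [prob, expect]

lemma prob_union_le (A B : Set (I → β)) : prob μ (A ∪ B) ≤ prob μ A + prob μ B := by
  rw [prob, prob, prob, ← expect_add]
  refine hμ.expect_mono fun ω => ?_
  by_cases hA : ω ∈ A <;> by_cases hB : ω ∈ B <;> simp [Set.indicator, hA, hB]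

lemma prob_biUnion_le {A : Type*} (s : Finset A) (f : A → Set (I → β)) :
    prob μ (⋃ a ∈ s, f a) ≤ ∑ a ∈ s, prob μ (f a) := by
  classical
  induction s using Finset.induction_on with
  | empty => simp [prob_empty]
  | insert a s ha ih =>
    rw [Finset.set_biUnion_insert, Finset.sum_insert ha]
    exact (hμ.prob_union_le _ _).trans (by gcongr)

omit hμ in
lemma prob_diff_add_inter (A B : Set (I → β)) : prob μ (A \ B) + prob μ (A ∩ B) = prob μ A := by
  rw [prob, prob, prob, ← expect_add]
  congr 1
  ext ω
  by_cases hA : ω ∈ A <;> by_cases hB : ω ∈ B <;> simp [Set.indicator, hA, hB]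

lemma prob_le_exp_mul_expect (f : (I → β) → ℝ) (t : ℝ) :
    prob μ {ω | t ≤ f ω} ≤ Real.exp (-t) * expect μ (fun ω => Real.exp (f ω)) := by
  rw [← expect_const_mul]
  refine hμ.expect_mono fun ω => ?_
  by_cases h : t ≤ f ω
  · simp only [Set.indicator, Set.mem_ofPred_eq, h, if_true, Pi.one_apply, ← Real.exp_add]
    exact Real.one_le_exp (by linarith)
  · simp only [Set.indicator, Set.mem_ofPred_eq, h, if_false]
    positivity

end IsProbFamily

/-- Exchanging the coordinates in `T` between two independent samples. -/
lemma expect_expect_piecewise (T : Finset I) (F : (I → β) → (I → β) → ℝ) :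
    expect μ (fun ω => expect μ (fun ω' => F (T.piecewise ω' ω) (T.piecewise ω ω'))) =
      expect μ (fun ω => expect μ (fun ω' => F ω ω')) := by
  simp only [expect, Finset.mul_sum, ← Fintype.sum_prod_type']
  have hinv : Function.Involutive (fun q : (I → β) × (I → β) =>
      (T.piecewise q.2 q.1, T.piecewise q.1 q.2)) := by
    intro q
    refine Prod.ext ?_ ?_ <;> funext i <;> by_cases h : i ∈ T <;> simp [h]
  refine Fintype.sum_equiv hinv.toPerm _ _ fun q => ?_
  simp only [Function.Involutive.coe_toPerm, ← mul_assoc, ← Finset.prod_mul_distrib]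
  congr 1
  refine Finset.prod_congr rfl fun i _ => ?_
  by_cases h : i ∈ T <;> simp [h, mul_comm]

/-- Resampling the coordinates in `T` from an independent copy preserves the distribution, and
afterwards `f` sees only the copy and `g` only the original. -/
lemma expect_mul_of_disjoint (hμ : IsProbFamily μ) {f g : (I → β) → ℝ} {S T : Finset I}
    (hf : DependsOn f (T : Set I)) (hg : DependsOn g (S : Set I)) (h : Disjoint S T) :
    expect μ (fun ω => f ω * g ω) = expect μ f * expect μ g := by
  have := expect_expect_piecewise (μ := μ) T (fun ω _ => f ω * g ω)
  simp only [hμ.expect_const] at this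
  rw [← this]
  have e : ∀ ω ω' : I → β, f (T.piecewise ω' ω) * g (T.piecewise ω' ω) = f ω' * g ω := by
    intro ω ω'
    rw [hf (y := ω') fun i hi => by simp [Finset.mem_coe.1 hi],
      hg (y := ω) fun i hi => by simp [Finset.disjoint_left.1 h (Finset.mem_coe.1 hi)]]
  simp only [e, expect_mul_const, expect_const_mul]

/-- Averaging over the coordinate `i`. -/
noncomputable def avg (μ : I → β → ℝ) (i : I) (f : (I → β) → ℝ) (ω : I → β) : ℝ :=
  ∑ x, μ i x * f (update ω i x)

lemma expect_avg (hμ : IsProbFamily μ) (i : I) (f : (I → β) → ℝ) :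
    expect μ (avg μ i f) = expect μ f := by
  have := expect_expect_piecewise (μ := μ) {i} (fun ω _ => f ω)
  simp only [hμ.expect_const] at this
  rw [← this]
  congr 1
  ext ω
  rw [avg, ← hμ.expect_eval i (fun x => f (update ω i x))]
  congr 1
  ext ω'
  rw [Finset.piecewise_singleton]

/-! ### Exponential moments -/

/-- Expand around `a` with `exp y ≤ 1 + y + y ^ 2` for `|y| ≤ 1`, integrate, and return to an
exponential by `1 + y ≤ exp y`. The deviation `g` is weighted by `ν`, so rare values with a large
effect cost little. -/
lemma sum_mul_exp_le {ν : β → ℝ} (h0 : ∀ x, 0 ≤ ν x) (h1 : ∑ x, ν x = 1) (h g : β → ℝ) (a t : ℝ)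
    (ht : 0 ≤ t) (hg : ∀ x, |h x - a| ≤ g x) (hB : ∀ x, t * g x ≤ 1) :
    ∑ x, ν x * Real.exp (t * h x) ≤
      Real.exp (t * ∑ x, ν x * h x + t ^ 2 * ∑ x, ν x * g x ^ 2) := by
  have hpt : ∀ x, Real.exp (t * h x) ≤
      Real.exp (t * a) * (1 + t * (h x - a) + t ^ 2 * g x ^ 2) := by
    intro x
    have hx : |t * (h x - a)| ≤ t * g x := by
      rw [abs_mul, abs_of_nonneg ht]
      exact mul_le_mul_of_nonneg_left (hg x) ht
    have h2 := Real.abs_exp_sub_one_sub_id_le (hx.trans (hB x))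
    have h3 : (t * (h x - a)) ^ 2 ≤ t ^ 2 * g x ^ 2 := by
      rw [← mul_pow, ← sq_abs (t * (h x - a))]
      exact pow_le_pow_left₀ (abs_nonneg _) hx 2
    have h4 : t * h x = t * a + t * (h x - a) := by ring
    rw [h4, Real.exp_add]
    refine mul_le_mul_of_nonneg_left ?_ (Real.exp_pos _).le
    linarith [le_abs_self (Real.exp (t * (h x - a)) - 1 - t * (h x - a))]
  calc ∑ x, ν x * Real.exp (t * h x)
      ≤ ∑ x, ν x * (Real.exp (t * a) * (1 + t * (h x - a) + t ^ 2 * g x ^ 2)) :=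
        Finset.sum_le_sum fun x _ => mul_le_mul_of_nonneg_left (hpt x) (h0 x)
    _ = ∑ x, (Real.exp (t * a) * (1 - t * a) * ν x + Real.exp (t * a) * t * (ν x * h x) +
          Real.exp (t * a) * t ^ 2 * (ν x * g x ^ 2)) :=
        Finset.sum_congr rfl fun x _ => by ring
    _ = Real.exp (t * a) * ((t * ∑ x, ν x * h x - t * a + t ^ 2 * ∑ x, ν x * g x ^ 2) + 1) := by
        rw [Finset.sum_add_distrib, Finset.sum_add_distrib, ← Finset.mul_sum, ← Finset.mul_sum,
          ← Finset.mul_sum, h1]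
        ring
    _ ≤ Real.exp (t * a) *
          Real.exp (t * ∑ x, ν x * h x - t * a + t ^ 2 * ∑ x, ν x * g x ^ 2) :=
        mul_le_mul_of_nonneg_left (Real.add_one_le_exp _) (Real.exp_pos _).le
    _ = _ := by
        rw [← Real.exp_add]
        congr 1
        ring

/-- Averaging out one coordinate removes the dependence on it, keeps the deviation bounds for the
others, and costs one factor from `sum_mul_exp_le`. -/
lemma expect_exp_le_of_dependsOn (hμ : IsProbFamily μ) (b : I → β) (g : I → β → ℝ) (t : ℝ)
    (ht : 0 ≤ t) (hB : ∀ i x, t * g i x ≤ 1) (s : Finset I) :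
    ∀ f : (I → β) → ℝ, DependsOn f (s : Set I) →
      (∀ ω i, |f ω - f (update ω i (b i))| ≤ g i (ω i)) →
      expect μ (fun ω => Real.exp (t * f ω)) ≤
        Real.exp (t * expect μ f + t ^ 2 * ∑ i ∈ s, ∑ x, μ i x * g i x ^ 2) := by
  induction s using Finset.induction_on with
  | empty =>
    intro f hf _
    obtain ⟨c, rfl⟩ : ∃ c, f = fun _ => c := by
      by_cases h : Nonempty (I → β)
      · obtain ⟨ω⟩ := h
        exact ⟨f ω, funext fun ω' => hf fun i hi => by simp at hi⟩
      · exact ⟨0, funext fun ω => (h ⟨ω⟩).elim⟩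
    simp [hμ.expect_const]
  | insert i s hi ih =>
    intro f hf hlip
    have havg : DependsOn (avg μ i f) (s : Set I) := by
      intro ω ω' h
      simp only [avg]
      refine Finset.sum_congr rfl fun x _ => ?_
      congr 1
      refine hf fun j hj => ?_
      by_cases hji : j = i
      · subst hji; simp
      · rw [update_of_ne hji, update_of_ne hji]
        refine h j ?_
        simpa [hji] using hj
    have hlip' : ∀ ω j, |avg μ i f ω - avg μ i f (update ω j (b j))| ≤ g j (ω j) := by
      intro ω j
      by_cases hji : j = i
      · subst hji
        simp only [avg, update_idem, sub_self, abs_zero]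
        exact (abs_nonneg _).trans (hlip ω j)
      · simp only [avg, ← Finset.sum_sub_distrib, ← mul_sub]
        calc |∑ x, μ i x * (f (update ω i x) - f (update (update ω j (b j)) i x))|
            ≤ ∑ x, |μ i x * (f (update ω i x) - f (update (update ω j (b j)) i x))| :=
              Finset.abs_sum_le_sum_abs _ _
          _ ≤ ∑ x, μ i x * g j (ω j) := by
              refine Finset.sum_le_sum fun x _ => ?_
              rw [abs_mul, abs_of_nonneg (hμ.nonneg i x), update_comm hji]
              refine mul_le_mul_of_nonneg_left ?_ (hμ.nonneg i x)
              have := hlip (update ω i x) j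
              rwa [update_of_ne hji] at this
          _ = g j (ω j) := by rw [← Finset.sum_mul, hμ.sum_one, one_mul]
    have hstep : ∀ ω, avg μ i (fun ω => Real.exp (t * f ω)) ω ≤
        Real.exp (t * avg μ i f ω) * Real.exp (t ^ 2 * ∑ x, μ i x * g i x ^ 2) := by
      intro ω
      rw [← Real.exp_add]
      refine sum_mul_exp_le (hμ.nonneg i) (hμ.sum_one i) (fun x => f (update ω i x)) (g i)
        (f (update ω i (b i))) t ht (fun x => ?_) (hB i)
      have := hlip (update ω i x) i
      rwa [update_idem, update_self] at this
    rw [← expect_avg hμ i]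
    calc expect μ (avg μ i fun ω => Real.exp (t * f ω))
        ≤ expect μ (fun ω => Real.exp (t * avg μ i f ω) *
            Real.exp (t ^ 2 * ∑ x, μ i x * g i x ^ 2)) := hμ.expect_mono hstep
      _ = expect μ (fun ω => Real.exp (t * avg μ i f ω)) *
            Real.exp (t ^ 2 * ∑ x, μ i x * g i x ^ 2) := expect_mul_const _ _
      _ ≤ Real.exp (t * expect μ (avg μ i f) + t ^ 2 * ∑ i ∈ s, ∑ x, μ i x * g i x ^ 2) *
            Real.exp (t ^ 2 * ∑ x, μ i x * g i x ^ 2) :=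
          mul_le_mul_of_nonneg_right (ih _ havg hlip') (Real.exp_pos _).le
      _ = _ := by
          rw [← Real.exp_add, expect_avg hμ, Finset.sum_insert hi]
          congr 1
          ring

/-- An exponential moment bound for functions of independent variables, where the effect of
a coordinate is measured by comparison with a fixed base value. -/
lemma expect_exp_le (hμ : IsProbFamily μ) (b : I → β) (g : I → β → ℝ) (t : ℝ)
    (ht : 0 ≤ t) (hB : ∀ i x, t * g i x ≤ 1) (f : (I → β) → ℝ)
    (hlip : ∀ ω i, |f ω - f (update ω i (b i))| ≤ g i (ω i)) :
    expect μ (fun ω => Real.exp (t * f ω)) ≤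
      Real.exp (t * expect μ f + t ^ 2 * ∑ i, ∑ x, μ i x * g i x ^ 2) :=
  expect_exp_le_of_dependsOn hμ b g t ht hB Finset.univ f
    (fun ω ω' h => by rw [show ω = ω' from funext fun i => h i (by simp)]) hlip

/-- An upper tail bound for `∑ u ∈ s, X u` where the coordinates are exposed in the order of the
indices and each `X u` has small probability to be one conditionally on the past. -/
lemma expect_exp_sum_le_of_ordered {A : Type*} [LinearOrder A] (hμ : IsProbFamily μ)
    (X : A → (I → β) → ℝ) (c : A → I) (q : ℝ) (hq : ∀ u ω, avg μ (c u) (X u) ω ≤ q)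
    (h01 : ∀ u ω, X u ω = 0 ∨ X u ω = 1) (s : Finset A)
    (hdep : ∀ u ∈ s, ∀ v ∈ s, u < v → ∀ ω x, X u (update ω (c v) x) = X u ω) :
    expect μ (fun ω => Real.exp (∑ u ∈ s, X u ω)) ≤ Real.exp (2 * q * s.card) := by
  induction s using Finset.induction_on_max with
  | empty => simp [hμ.expect_const]
  | insert v s hmax ih =>
    have hv : v ∉ s := fun h => lt_irrefl _ (hmax v h)
    have hq0 : 0 ≤ q := by
      by_cases h : Nonempty (I → β)
      · obtain ⟨ω⟩ := h
        refine le_trans (Finset.sum_nonneg fun x _ => mul_nonneg (hμ.nonneg _ _) ?_) (hq v ω)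
        rcases h01 v (update ω (c v) x) with h | h <;> simp [h]
      · have := hμ.prob_univ
        rw [Set.univ_eq_empty_iff.2 (not_nonempty_iff.1 h), IsProbFamily.prob_empty] at this
        norm_num at this
    -- The largest index is averaged first, as no earlier summand depends on its coordinate. For
    -- values in `{0, 1}`, `exp X ≤ 1 + 2 * X` because `e < 3`.
    have hstep : ∀ ω, avg μ (c v) (fun ω => Real.exp (∑ u ∈ insert v s, X u ω)) ω ≤
        Real.exp (∑ u ∈ s, X u ω) * Real.exp (2 * q) := by
      intro ω
      have hx : ∀ x, Real.exp (∑ u ∈ insert v s, X u (update ω (c v) x)) ≤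
          Real.exp (∑ u ∈ s, X u ω) * (1 + 2 * X v (update ω (c v) x)) := by
        intro x
        rw [Finset.sum_insert hv, Real.exp_add, mul_comm,
          Finset.sum_congr rfl fun u hu => hdep u (Finset.mem_insert_of_mem hu) v
            (Finset.mem_insert_self _ _) (hmax u hu) ω x]
        refine mul_le_mul_of_nonneg_left ?_ (Real.exp_pos _).le
        rcases h01 v (update ω (c v) x) with h | h
        · simp [h]
        · rw [h]
          linarith [Real.exp_one_lt_d9]
      calc avg μ (c v) (fun ω => Real.exp (∑ u ∈ insert v s, X u ω)) ω
          ≤ ∑ x, μ (c v) x *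
              (Real.exp (∑ u ∈ s, X u ω) * (1 + 2 * X v (update ω (c v) x))) :=
            Finset.sum_le_sum fun x _ => mul_le_mul_of_nonneg_left (hx x) (hμ.nonneg _ _)
        _ = Real.exp (∑ u ∈ s, X u ω) * (1 + 2 * avg μ (c v) (X v) ω) := by
            have : ∀ x, μ (c v) x *
                (Real.exp (∑ u ∈ s, X u ω) * (1 + 2 * X v (update ω (c v) x))) =
                Real.exp (∑ u ∈ s, X u ω) * μ (c v) x + Real.exp (∑ u ∈ s, X u ω) * 2 *
                  (μ (c v) x * X v (update ω (c v) x)) := fun x => by ring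
            rw [Finset.sum_congr rfl fun x _ => this x, Finset.sum_add_distrib, ← Finset.mul_sum,
              ← Finset.mul_sum, hμ.sum_one, avg]
            ring
        _ ≤ Real.exp (∑ u ∈ s, X u ω) * Real.exp (2 * q) := by
            refine mul_le_mul_of_nonneg_left ?_ (Real.exp_pos _).le
            linarith [Real.add_one_le_exp (2 * q), hq v ω]
    rw [← expect_avg hμ (c v)]
    calc _ ≤ expect μ (fun ω => Real.exp (∑ u ∈ s, X u ω) * Real.exp (2 * q)) :=
          hμ.expect_mono hstep
      _ = expect μ (fun ω => Real.exp (∑ u ∈ s, X u ω)) * Real.exp (2 * q) :=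
          expect_mul_const _ _
      _ ≤ Real.exp (2 * q * s.card) * Real.exp (2 * q) :=
          mul_le_mul_of_nonneg_right (ih fun u hu w hw => hdep u (Finset.mem_insert_of_mem hu) w
            (Finset.mem_insert_of_mem hw)) (Real.exp_pos _).le
      _ = _ := by
          rw [← Real.exp_add, Finset.card_insert_of_notMem hv]
          push_cast
          congr 1
          ring

/-! ### Counting the members of a family whose forbidden values are avoided -/

section AvoidCount

variable [DecidableEq β]

/-- The number of `a ∈ N` such that no coordinate takes a value forbidden by `R a`. -/
noncomputable def avoidCount {A : Type*} (N : Finset A) (R : A → Finset (I × β)) (ω : I → β) : ℝ :=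
  ∑ a ∈ N, if ∀ r ∈ R a, ω r.1 ≠ r.2 then 1 else 0

lemma avoidCount_congr {A : Type*} (N : Finset A) (R : A → Finset (I × β)) {ω ω' : I → β}
    (h : ∀ a ∈ N, ∀ r ∈ R a, ω r.1 = ω' r.1) : avoidCount N R ω = avoidCount N R ω' := by
  refine Finset.sum_congr rfl fun a ha => ?_
  congr 1
  rw [eq_iff_iff]
  exact forall₂_congr fun r hr => by rw [h a ha r hr]

lemma expect_avoid (hμ : IsProbFamily μ) (R : Finset (I × β)) :
    expect μ (fun ω => if ∀ r ∈ R, ω r.1 ≠ r.2 then 1 else 0) =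
      ∏ i, (1 - ∑ x with (i, x) ∈ R, μ i x) := by
  have e : ∀ ω : I → β, (if ∀ r ∈ R, ω r.1 ≠ r.2 then (1 : ℝ) else 0) =
      ∏ i, if (i, ω i) ∈ R then 0 else 1 := by
    intro ω
    by_cases h : ∀ r ∈ R, ω r.1 ≠ r.2
    · rw [if_pos h]
      exact (Finset.prod_eq_one fun i _ => if_neg fun hi => h _ hi rfl).symm
    · rw [if_neg h]
      push Not at h
      obtain ⟨⟨i, x⟩, hr, hx⟩ := h
      refine (Finset.prod_eq_zero (Finset.mem_univ i) ?_).symm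
      dsimp only at hx
      rw [hx, if_pos hr]
  simp only [e]
  rw [expect_prod (fun i x => if (i, x) ∈ R then 0 else 1)]
  refine Finset.prod_congr rfl fun i _ => ?_
  rw [eq_sub_iff_add_eq, Finset.sum_filter, ← Finset.sum_add_distrib]
  refine Eq.trans (Finset.sum_congr rfl fun x _ => ?_) (hμ.sum_one i)
  by_cases h : (i, x) ∈ R <;> simp [h]

/-- The base value `b i` is never forbidden, so moving coordinate `i` to it can only matter to those
`a` that forbid the current value. -/
lemma abs_avoidCount_sub_le {A : Type*} (N : Finset A) (R : A → Finset (I × β)) (b : I → β)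
    (hb : ∀ a ∈ N, ∀ i, (i, b i) ∉ R a) (ω : I → β) (i : I) :
    |avoidCount N R ω - avoidCount N R (update ω i (b i))| ≤ ({a ∈ N | (i, ω i) ∈ R a}.card : ℝ) := by
  rw [avoidCount, avoidCount, ← Finset.sum_sub_distrib, Finset.card_filter]
  push_cast
  refine (Finset.abs_sum_le_sum_abs _ _).trans (Finset.sum_le_sum fun a ha => ?_)
  by_cases hi : (i, ω i) ∈ R a
  · rw [if_pos hi]
    split_ifs <;> simp
  · rw [if_neg hi]
    have : (∀ r ∈ R a, update ω i (b i) r.1 ≠ r.2) ↔ ∀ r ∈ R a, ω r.1 ≠ r.2 := by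
      refine forall₂_congr fun r hr => ?_
      by_cases hri : r.1 = i
      · obtain ⟨j, x⟩ := r
        dsimp only at hri ⊢
        subst hri
        rw [update_self]
        refine ⟨fun _ h => hi (h ▸ hr), fun _ h => hb a ha j (h ▸ hr)⟩
      · rw [update_of_ne hri]
    simp only [this, sub_self, abs_zero, le_refl]

/-- One factor of the square is bounded by `K`; double counting the other gives, for each `a`, the
expected number of its forbidden values that occur. -/
lemma sum_mul_card_sq_le {A : Type*} (hμ : IsProbFamily μ) (N : Finset A)
    (R : A → Finset (I × β)) (K m : ℝ) (hK : ∀ i x, ({a ∈ N | (i, x) ∈ R a}.card : ℝ) ≤ K)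
    (hK0 : 0 ≤ K) (hm : ∀ a ∈ N, ∑ r ∈ R a, μ r.1 r.2 ≤ m) :
    ∑ i, ∑ x, μ i x * ({a ∈ N | (i, x) ∈ R a}.card : ℝ) ^ 2 ≤ K * (m * N.card) := by
  calc ∑ i, ∑ x, μ i x * ({a ∈ N | (i, x) ∈ R a}.card : ℝ) ^ 2
      ≤ ∑ i, ∑ x, K * ∑ a ∈ N, if (i, x) ∈ R a then μ i x else 0 := by
        refine Finset.sum_le_sum fun i _ => Finset.sum_le_sum fun x _ => ?_
        rw [← Finset.sum_filter, Finset.sum_const, nsmul_eq_mul, sq, mul_comm, mul_assoc]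
        exact mul_le_mul_of_nonneg_right (hK i x) (mul_nonneg (Nat.cast_nonneg _) (hμ.nonneg _ _))
    _ = K * ∑ a ∈ N, ∑ r ∈ R a, μ r.1 r.2 := by
        simp only [← Finset.mul_sum]
        congr 1
        rw [← Fintype.sum_prod_type', Finset.sum_comm]
        refine Finset.sum_congr rfl fun a _ => ?_
        rw [← Finset.sum_filter]
        simp
    _ ≤ K * (m * N.card) := by
        refine mul_le_mul_of_nonneg_left ?_ hK0
        calc _ ≤ ∑ a ∈ N, m := Finset.sum_le_sum hm
          _ = _ := by rw [Finset.sum_const, nsmul_eq_mul, mul_comm]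

/-- Concentration of `avoidCount`, both tails. -/
lemma prob_avoidCount_le {A : Type*} (hμ : IsProbFamily μ) (N : Finset A)
    (R : A → Finset (I × β)) (b : I → β) (hb : ∀ a ∈ N, ∀ i, (i, b i) ∉ R a) (K m t E y : ℝ)
    (hK : ∀ i x, ({a ∈ N | (i, x) ∈ R a}.card : ℝ) ≤ K) (hK0 : 0 ≤ K)
    (hm : ∀ a ∈ N, ∑ r ∈ R a, μ r.1 r.2 ≤ m) (ht : 0 ≤ t) (htK : t * K ≤ 1) :
    (expect μ (avoidCount N R) ≤ E →
      prob μ {ω | E + y ≤ avoidCount N R ω} ≤ Real.exp (t ^ 2 * (K * (m * N.card)) - t * y)) ∧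
    (E ≤ expect μ (avoidCount N R) →
      prob μ {ω | avoidCount N R ω ≤ E - y} ≤ Real.exp (t ^ 2 * (K * (m * N.card)) - t * y)) := by
  have hvar := sum_mul_card_sq_le hμ N R K m hK hK0 hm
  have hB : ∀ i x, t * ({a ∈ N | (i, x) ∈ R a}.card : ℝ) ≤ 1 := fun i x =>
    (mul_le_mul_of_nonneg_left (hK i x) ht).trans htK
  have hlip := abs_avoidCount_sub_le N R b hb
  constructor
  · intro hE
    calc prob μ {ω | E + y ≤ avoidCount N R ω}
        ≤ prob μ {ω | t * (E + y) ≤ t * avoidCount N R ω} :=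
          hμ.prob_mono fun ω hω => mul_le_mul_of_nonneg_left hω ht
      _ ≤ _ := hμ.prob_le_exp_mul_expect _ _
      _ ≤ Real.exp (-(t * (E + y))) * Real.exp (t * expect μ (avoidCount N R) + t ^ 2 *
            ∑ i, ∑ x, μ i x * ({a ∈ N | (i, x) ∈ R a}.card : ℝ) ^ 2) :=
          mul_le_mul_of_nonneg_left (expect_exp_le hμ b _ t ht hB _ hlip) (Real.exp_pos _).le
      _ ≤ _ := by
          rw [← Real.exp_add]
          refine Real.exp_le_exp.2 ?_
          nlinarith [mul_le_mul_of_nonneg_left hvar (sq_nonneg t), mul_le_mul_of_nonneg_left hE ht]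
  · intro hE
    have hlip' : ∀ ω i, |(-avoidCount N R ω) - (-avoidCount N R (update ω i (b i)))| ≤
        ({a ∈ N | (i, ω i) ∈ R a}.card : ℝ) := fun ω i => by
      rw [neg_sub_neg, abs_sub_comm]
      exact hlip ω i
    calc prob μ {ω | avoidCount N R ω ≤ E - y}
        ≤ prob μ {ω | t * (y - E) ≤ t * (-avoidCount N R ω)} :=
          hμ.prob_mono fun ω (hω : avoidCount N R ω ≤ E - y) =>
            mul_le_mul_of_nonneg_left (by linarith) ht
      _ ≤ _ := hμ.prob_le_exp_mul_expect _ _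
      _ ≤ Real.exp (-(t * (y - E))) * Real.exp (t * expect μ (fun ω => -avoidCount N R ω) + t ^ 2 *
            ∑ i, ∑ x, μ i x * ({a ∈ N | (i, x) ∈ R a}.card : ℝ) ^ 2) :=
          mul_le_mul_of_nonneg_left (expect_exp_le hμ b _ t ht hB _ hlip') (Real.exp_pos _).le
      _ ≤ _ := by
          rw [← Real.exp_add, expect_neg]
          refine Real.exp_le_exp.2 ?_
          nlinarith [mul_le_mul_of_nonneg_left hvar (sq_nonneg t), mul_le_mul_of_nonneg_left hE ht]

end AvoidCount

/-! ### The local lemma -/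

lemma prob_inter_of_disjoint (hμ : IsProbFamily μ) {A B : Set (I → β)} {S T : Finset I}
    (hA : DependsOn (· ∈ A) (T : Set I)) (hB : DependsOn (· ∈ B) (S : Set I))
    (h : Disjoint S T) : prob μ (A ∩ B) = prob μ A * prob μ B := by
  classical
  rw [prob, prob, prob, ← expect_mul_of_disjoint hμ (S := S) (T := T) _ _ h]
  · congr 1
    ext ω
    by_cases h1 : ω ∈ A <;> by_cases h2 : ω ∈ B <;> simp [h1, h2]
  · intro ω ω' hω
    have := hA hω
    simp only [eq_iff_iff] at this
    simp [Set.indicator, this]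
  · intro ω ω' hω
    have := hB hω
    simp only [eq_iff_iff] at this
    simp [Set.indicator, this]

/-- The symmetric Lovász local lemma for events in a finite product space. -/
theorem exists_forall_notMem_of_local {J : Type*} [Fintype J] (hμ : IsProbFamily μ)
    (A : J → Set (I → β)) (T : J → Finset I) (hdep : ∀ j, DependsOn (· ∈ A j) (T j : Set I))
    (x : ℝ) (Δ : ℝ) (hx : ∀ j, prob μ (A j) ≤ x) (hΔ1 : 1 ≤ Δ)
    (hΔ : ∀ j, ({k | ¬ Disjoint (T j) (T k)}.ncard : ℝ) ≤ Δ) (hxΔ : 4 * x * Δ ≤ 1) :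
    ∃ ω, ∀ j, ω ∉ A j := by
  classical
  let N : Finset J → Set (I → β) := fun S => {ω | ∀ k ∈ S, ω ∉ A k}
  have hNins : ∀ j S, N (insert j S) = N S \ A j := by
    intro j S
    ext ω
    simp [N, and_comm]
  -- Avoiding the events in `S` has positive probability, and conditionally on this each event has
  -- probability at most `2 * x`.
  have key : ∀ n : ℕ, ∀ S : Finset J, S.card ≤ n →
      0 < prob μ (N S) ∧ ∀ j, prob μ (A j ∩ N S) ≤ 2 * x * prob μ (N S) := by
    intro n
    induction n with
    | zero =>
      intro S hS
      obtain rfl : S = ∅ := Finset.card_eq_zero.1 (by omega)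
      have : N ∅ = Set.univ := by simp [N]
      rw [this, hμ.prob_univ]
      refine ⟨one_pos, fun j => ?_⟩
      rw [Set.inter_univ]
      linarith [hx j, hμ.prob_nonneg (A j)]
    | succ n ih =>
      intro S hS
      have hcond : ∀ j, ∀ S : Finset J, S.card ≤ n + 1 →
          prob μ (A j ∩ N S) ≤ 2 * x * prob μ (N S) := by
        intro j S hS
        have hx0 : 0 ≤ x := (hμ.prob_nonneg _).trans (hx j)
        let S1 := S.filter fun k => ¬ Disjoint (T j) (T k)
        let S2 := S.filter fun k => Disjoint (T j) (T k)
        have hsub2 : N S ⊆ N S2 := fun ω hω k hk => hω k (Finset.mem_filter.1 hk).1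
        have hind : prob μ (A j ∩ N S2) = prob μ (A j) * prob μ (N S2) := by
          refine prob_inter_of_disjoint hμ (S := S2.biUnion T) (T := T j) (hdep j) ?_ ?_
          · intro ω ω' h
            simp only [N, Set.mem_ofPred_eq, eq_iff_iff]
            refine forall₂_congr fun k hk => not_congr ?_
            have := hdep k (x := ω) (y := ω') fun i hi => h i
              (by simpa using ⟨k, hk, by simpa using hi⟩)
            simpa using this
          · rw [Finset.disjoint_biUnion_left]
            exact fun k hk => (Finset.mem_filter.1 hk).2.symm
        -- By induction the at most `Δ` events of `S1` each occupy at most a fraction `2 * x` of `N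
        -- S2`, in total at most half of it. If `S1` is empty, `S2` is no smaller than `S` and the
        -- induction hypothesis is not needed.
        have hhalf : prob μ (N S2) ≤ 2 * prob μ (N S) := by
          rcases S1.eq_empty_or_nonempty with h0 | hne
          · have : S2 = S := by
              refine Finset.filter_true_of_mem fun k hk => ?_
              by_contra hcon
              have : k ∈ S1 := Finset.mem_filter.2 ⟨hk, hcon⟩
              simp [h0] at this
            rw [this]
            linarith [hμ.prob_nonneg (N S)]
          · have hcard : S2.card ≤ n := by
              have := Finset.card_filter_add_card_filter_not
                (s := S) (fun k => Disjoint (T j) (T k))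
              have h1 : 0 < S1.card := hne.card_pos
              change S2.card + S1.card = S.card at this
              omega
            have hS1 : (S1.card : ℝ) ≤ Δ := by
              refine le_trans ?_ (hΔ j)
              rw [← Set.ncard_coe_finset]
              refine Nat.cast_le.2 (Set.ncard_le_ncard ?_ (Set.toFinite _))
              intro k hk
              exact (Finset.mem_filter.1 hk).2
            have hcover : N S2 ⊆ N S ∪ ⋃ k ∈ S1, (A k ∩ N S2) := by
              intro ω hω
              by_cases h : ω ∈ N S
              · exact Or.inl h
              · right
                simp only [N, Set.mem_ofPred_eq, not_forall, not_not] at h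
                obtain ⟨k, hk, hωk⟩ := h
                simp only [Set.mem_iUnion]
                refine ⟨k, Finset.mem_filter.2 ⟨hk, fun hd => ?_⟩, hωk, hω⟩
                exact hω k (Finset.mem_filter.2 ⟨hk, hd⟩) hωk
            have h1 : prob μ (N S2) ≤ prob μ (N S) + ∑ k ∈ S1, prob μ (A k ∩ N S2) :=
              (hμ.prob_mono hcover).trans ((hμ.prob_union_le _ _).trans
                (add_le_add le_rfl (hμ.prob_biUnion_le _ _)))
            have h2 : ∑ k ∈ S1, prob μ (A k ∩ N S2) ≤ S1.card * (2 * x * prob μ (N S2)) := by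
              rw [← nsmul_eq_mul]
              exact Finset.sum_le_card_nsmul _ _ _ fun k _ => (ih S2 hcard).2 k
            have h3 := (ih S2 hcard).1
            have h4 : (S1.card : ℝ) * (2 * x * prob μ (N S2)) ≤ Δ * (2 * x * prob μ (N S2)) :=
              mul_le_mul_of_nonneg_right hS1 (by positivity)
            nlinarith
        calc prob μ (A j ∩ N S) ≤ prob μ (A j ∩ N S2) :=
              hμ.prob_mono (Set.inter_subset_inter_right _ hsub2)
          _ = prob μ (A j) * prob μ (N S2) := hind
          _ ≤ x * (2 * prob μ (N S)) := mul_le_mul (hx j) hhalf (hμ.prob_nonneg _) hx0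
          _ = _ := by ring
      refine ⟨?_, fun j => hcond j S hS⟩
      rcases S.eq_empty_or_nonempty with rfl | ⟨j, hj⟩
      · exact (ih ∅ (by simp)).1
      · have hc := Finset.card_erase_of_mem hj
        have hpos := Finset.card_pos.2 ⟨j, hj⟩
        obtain ⟨h1, h2⟩ := ih (S.erase j) (by omega)
        rw [← Finset.insert_erase hj, hNins]
        have h3 := IsProbFamily.prob_diff_add_inter (μ := μ) (N (S.erase j)) (A j)
        rw [Set.inter_comm] at h3
        have hx0 : 0 ≤ x := (hμ.prob_nonneg _).trans (hx j)
        nlinarith [h2 j]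
  obtain ⟨hpos, -⟩ := key _ Finset.univ le_rfl
  by_contra! hcon
  have : N Finset.univ = ∅ := by
    ext ω
    obtain ⟨j, hj⟩ := hcon ω
    simp only [N, Set.mem_ofPred_eq, Set.mem_empty_iff_false, iff_false, not_forall, not_not]
    exact ⟨j, Finset.mem_univ j, hj⟩
  rw [this, IsProbFamily.prob_empty] at hpos
  exact lt_irrefl _ hpos

end Expectation

/-! ### Covers, and what a round of coloring leaves to be colored. -/

section Cover

open Classical

variable {V ι : Type*} {l : ℕ}

/-- The conflict relation of a correspondence coloring problem with the color set `Fin l` at every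
vertex. The set `I v` consists of the indices of the graphs that contain `v`. -/
structure IsCover [Fintype V] (I : V → Finset ι) (E : V × Fin l → V × Fin l → Prop)
    (C d : ℕ) : Prop where
  card_le : ∀ v, (I v).card ≤ C
  unique : ∀ u v i j, u ≠ v → i ∈ I u → i ∈ I v → j ∈ I u → j ∈ I v → i = j
  symm : ∀ a b, E a b → E b a
  ne : ∀ a b, E a b → a.1 ≠ b.1
  common : ∀ a b, E a b → ∃ i, i ∈ I a.1 ∧ i ∈ I b.1
  matching : ∀ a b b', E a b → E a b' → b.1 = b'.1 → b = b'
  degree_le : ∀ a, ∀ i ∈ I a.1, {b | E a b ∧ i ∈ I b.1}.ncard ≤ d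

/-- There is a choice of one color at each vertex without conflicts. -/
def CoverColorable (E : V × Fin l → V × Fin l → Prop) : Prop :=
  ∃ φ : V → Fin l, ∀ u v, ¬ E (u, φ u) (v, φ v)

variable [Fintype V]

/-- The vertex-color pairs in conflict with `a`. -/
noncomputable def nbr (E : V × Fin l → V × Fin l → Prop) (a : V × Fin l) : Finset (V × Fin l) :=
  {b | E a b}

/-- The vertex-color pairs in conflict with `a` whose vertex is in the graph with index `i`. -/
noncomputable def nbrIn (I : V → Finset ι) (E : V × Fin l → V × Fin l → Prop) (i : ι)
    (a : V × Fin l) : Finset (V × Fin l) :=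
  {b | E a b ∧ i ∈ I b.1}

/-- The closed neighborhood of a vertex. -/
noncomputable def closedNbhd (E : V × Fin l → V × Fin l → Prop) (v : V) : Finset V :=
  {u | u = v ∨ ∃ c c', E (v, c) (u, c')}

variable {I : V → Finset ι} {E : V × Fin l → V × Fin l → Prop} {C d : ℕ}

@[simp] lemma mem_nbr {a b : V × Fin l} : b ∈ nbr E a ↔ E a b := by simp [nbr]

@[simp] lemma mem_nbrIn {i : ι} {a b : V × Fin l} : b ∈ nbrIn I E i a ↔ E a b ∧ i ∈ I b.1 := by
  simp [nbrIn]

lemma mem_closedNbhd {u v : V} : u ∈ closedNbhd E v ↔ u = v ∨ ∃ c c', E (v, c) (u, c') := by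
  simp [closedNbhd]

lemma self_mem_closedNbhd (v : V) : v ∈ closedNbhd E v := mem_closedNbhd.2 (Or.inl rfl)

lemma mem_closedNbhd_of_conflict {a b : V × Fin l} (h : E a b) : b.1 ∈ closedNbhd E a.1 :=
  mem_closedNbhd.2 (Or.inr ⟨a.2, b.2, h⟩)

namespace IsCover

variable (h : IsCover I E C d)
include h

lemma card_nbrIn_le {a : V × Fin l} {i : ι} (hi : i ∈ I a.1) : (nbrIn I E i a).card ≤ d := by
  rw [← Set.ncard_coe_finset]
  convert h.degree_le a i hi using 2
  ext b
  simp

lemma card_nbr_le (a : V × Fin l) : (nbr E a).card ≤ C * d := by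
  have hsub : nbr E a ⊆ (I a.1).biUnion fun i => nbrIn I E i a := by
    intro b hb
    rw [mem_nbr] at hb
    obtain ⟨i, hi, hi'⟩ := h.common a b hb
    exact Finset.mem_biUnion.2 ⟨i, hi, mem_nbrIn.2 ⟨hb, hi'⟩⟩
  exact (Finset.card_le_card hsub).trans
    ((Finset.card_biUnion_le_card_mul _ _ d fun i hi => h.card_nbrIn_le hi).trans
      (Nat.mul_le_mul_right d (h.card_le a.1)))

lemma mem_closedNbhd_comm {u v : V} (huv : u ∈ closedNbhd E v) : v ∈ closedNbhd E u := by
  rw [mem_closedNbhd] at huv ⊢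
  rcases huv with rfl | ⟨c, c', hc⟩
  · exact Or.inl rfl
  · exact Or.inr ⟨c', c, h.symm _ _ hc⟩

lemma card_closedNbhd_le (v : V) : (closedNbhd E v).card ≤ l * (C * d) + 1 := by
  have hsub : closedNbhd E v ⊆
      insert v ((Finset.univ : Finset (Fin l)).biUnion fun c => (nbr E (v, c)).image Prod.fst) := by
    intro u hu
    rcases mem_closedNbhd.1 hu with rfl | ⟨c, c', hc⟩
    · exact Finset.mem_insert_self _ _
    · refine Finset.mem_insert_of_mem (Finset.mem_biUnion.2 ⟨c, Finset.mem_univ _, ?_⟩)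
      exact Finset.mem_image.2 ⟨(u, c'), mem_nbr.2 hc, rfl⟩
  refine (Finset.card_le_card hsub).trans ((Finset.card_insert_le _ _).trans ?_)
  refine Nat.succ_le_succ ((Finset.card_biUnion_le_card_mul _ _ (C * d) fun c _ =>
    Finset.card_image_le.trans (h.card_nbr_le _)).trans ?_)
  simp

/-- Color uniformly at random. Each conflict occurs with probability `1 / l ^ 2` and shares a vertex
with at most `4 * l * C * d ≤ l ^ 2 / 4` others, which meets the condition of the local lemma. -/
lemma colorable_of_mul_le (hl : 2 ≤ l) (hd : 16 * (C * d) ≤ l) : CoverColorable E := by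
  have hl0 : (0 : ℝ) < l := by positivity
  let μ : V → Fin l → ℝ := fun _ _ => 1 / l
  have hμ : IsProbFamily μ := ⟨fun _ _ => by positivity, fun _ => by simp [μ]; field_simp⟩
  let J := {q : (V × Fin l) × (V × Fin l) // E q.1 q.2}
  let A : J → Set (V → Fin l) := fun q =>
    {ω | ω q.1.1.1 = q.1.1.2} ∩ {ω | ω q.1.2.1 = q.1.2.2}
  let T : J → Finset V := fun q => {q.1.1.1, q.1.2.1}
  have hone : ∀ a : V × Fin l, prob μ {ω : V → Fin l | ω a.1 = a.2} = 1 / l := by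
    intro a
    have := hμ.expect_eval a.1 fun x => if x = a.2 then 1 else 0
    simp only [mul_ite, mul_one, mul_zero, Finset.sum_ite_eq', Finset.mem_univ, if_true] at this
    rw [show (1 : ℝ) / l = μ a.1 a.2 from rfl, ← this, prob]
    congr 1
    ext ω
    by_cases hω : ω a.1 = a.2 <;> simp [hω]
  have hdepone : ∀ a : V × Fin l,
      DependsOn (· ∈ {ω : V → Fin l | ω a.1 = a.2}) (({a.1} : Finset V) : Set V) := by
    intro a ω ω' hω
    have := hω a.1 (by simp)
    simp [this]
  -- Conflicts are indexed by ordered pairs: two vertices to share and two orientations give the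
  -- factor four.
  have hcount : ∀ q : J, {k : J | ¬ Disjoint (T q) (T k)}.ncard ≤ 4 * (l * (C * d)) := by
    intro q
    let P : V → Finset ((V × Fin l) × (V × Fin l)) := fun w =>
      (Finset.univ : Finset (Fin l)).biUnion fun c => (nbr E (w, c)).image fun b => ((w, c), b)
    have hP : ∀ w, (P w).card ≤ l * (C * d) := fun w => by
      refine (Finset.card_biUnion_le_card_mul _ _ (C * d) fun c _ =>
        Finset.card_image_le.trans (h.card_nbr_le _)).trans ?_
      simp
    let U := (P q.1.1.1 ∪ (P q.1.1.1).image Prod.swap) ∪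
      (P q.1.2.1 ∪ (P q.1.2.1).image Prod.swap)
    have hU : U.card ≤ 4 * (l * (C * d)) := by
      have h1 := hP q.1.1.1
      have h2 := hP q.1.2.1
      have h3 := Finset.card_image_le (s := P q.1.1.1) (f := Prod.swap)
      have h4 := Finset.card_image_le (s := P q.1.2.1) (f := Prod.swap)
      have h5 := Finset.card_union_le (P q.1.1.1 ∪ (P q.1.1.1).image Prod.swap)
        (P q.1.2.1 ∪ (P q.1.2.1).image Prod.swap)
      have h6 := Finset.card_union_le (P q.1.1.1) ((P q.1.1.1).image Prod.swap)
      have h7 := Finset.card_union_le (P q.1.2.1) ((P q.1.2.1).image Prod.swap)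
      change _ ≤ _
      dsimp only [U]
      omega
    refine le_trans ?_ hU
    rw [← Set.ncard_coe_finset]
    refine Set.ncard_le_ncard_of_injOn Subtype.val ?_ Subtype.val_injective.injOn
      (Finset.finite_toSet _)
    rintro ⟨⟨a, b⟩, hab⟩ hk
    have hP1 : ((a, b) : (V × Fin l) × (V × Fin l)) ∈ P a.1 :=
      Finset.mem_biUnion.2 ⟨a.2, Finset.mem_univ _, Finset.mem_image.2 ⟨b, mem_nbr.2 hab, rfl⟩⟩
    have hP2 : ((a, b) : (V × Fin l) × (V × Fin l)) ∈ (P b.1).image Prod.swap :=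
      Finset.mem_image.2 ⟨(b, a), Finset.mem_biUnion.2 ⟨b.2, Finset.mem_univ _,
        Finset.mem_image.2 ⟨a, mem_nbr.2 (h.symm _ _ hab), rfl⟩⟩, rfl⟩
    rw [Set.mem_ofPred_eq, Finset.not_disjoint_iff] at hk
    obtain ⟨w, hw1, hw2⟩ := hk
    simp only [T, Finset.mem_insert, Finset.mem_singleton] at hw1 hw2
    simp only [U, Finset.coe_union, Set.mem_union, Finset.mem_coe]
    rcases hw1 with rfl | rfl <;> rcases hw2 with hw | hw <;> rw [hw] <;> tauto
  have hreal : (16 * (C * d) : ℝ) ≤ l := by exact_mod_cast hd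
  have hl2 : (2 : ℝ) ≤ l := by exact_mod_cast hl
  have hdep : ∀ q : J, DependsOn (· ∈ A q) (T q : Set V) := by
    intro q ω ω' hω
    have h1 := hω q.1.1.1 (by simp [T])
    have h2 := hω q.1.2.1 (by simp [T])
    simp [A, h1, h2]
  have hprob : ∀ q : J, prob μ (A q) ≤ 1 / l ^ 2 := by
    intro q
    refine le_of_eq ?_
    rw [prob_inter_of_disjoint hμ (hdepone q.1.1) (hdepone q.1.2)
      (by simpa using (h.ne _ _ q.2).symm), hone, hone]
    field_simp
  have hdeg : ∀ q : J, ({k : J | ¬ Disjoint (T q) (T k)}.ncard : ℝ) ≤ (l : ℝ) ^ 2 / 4 := by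
    intro q
    have : (({k : J | ¬ Disjoint (T q) (T k)}.ncard : ℕ) : ℝ) ≤ 4 * (l * (C * d)) := by
      exact_mod_cast hcount q
    nlinarith
  obtain ⟨ω, hω⟩ := exists_forall_notMem_of_local hμ A T hdep _ _ hprob (by nlinarith) hdeg
    (le_of_eq (by field_simp))
  exact ⟨ω, fun u v huv => hω ⟨((u, ω u), (v, ω v)), huv⟩ ⟨rfl, rfl⟩⟩

end IsCover

/-! ### One round of random coloring -/

section Round

variable [LinearOrder V]

/-- Coordinate `(v, none)` holds the tentative color of `v` (if there is one), and coordinate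
`(v, some c)` has the value `some c` if the color `c` is discarded at `v` by its coin flip. -/
abbrev Outcome (V : Type*) (l : ℕ) := V × Option (Fin l) → Option (Fin l)

/-- A conflict of the pair `a` with a tentative color of an earlier vertex. -/
def KilledEarly (E : V × Fin l → V × Fin l → Prop) (ω : Outcome V l) (a : V × Fin l) : Prop :=
  ∃ b, E a b ∧ b.1 < a.1 ∧ ω (b.1, none) = some b.2

/-- The colors that remain available at `v`. -/
noncomputable def newList (E : V × Fin l → V × Fin l → Prop) (ω : Outcome V l) (v : V) :
    Finset (Fin l) :=
  {c | ω (v, some c) ≠ some c ∧ ∀ b, E (v, c) b → ω (b.1, none) ≠ some b.2}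

/-- The vertex `v` does not retain a tentative color. -/
def Uncolored (E : V × Fin l → V × Fin l → Prop) (ω : Outcome V l) (v : V) : Prop :=
  ∀ x, ω (v, none) = some x → KilledEarly E ω (v, x)

/-- The conflicts of `a` in the graph with index `i` that remain after the round. -/
noncomputable def newNbrIn (I : V → Finset ι) (E : V × Fin l → V × Fin l → Prop)
    (ω : Outcome V l) (i : ι) (a : V × Fin l) : Finset (V × Fin l) :=
  {b ∈ nbrIn I E i a | Uncolored E ω b.1 ∧ b.2 ∈ newList E ω b.1}

/-- Of two conflicting tentative colors the later one is not kept, and the new lists avoid all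
tentative colors. Hence the kept colors extend any coloring of the uncolored vertices from sublists,
here trimmed to exactly `l'` colors. -/
lemma colorable_of_round (h : IsCover I E C d) (ω : Outcome V l) {l' d' : ℕ}
    (hl : ∀ v, l' ≤ (newList E ω v).card)
    (hd : ∀ a, ∀ i ∈ I a.1, (newNbrIn I E ω i a).card ≤ d')
    (hrec : ∀ (I' : {v // Uncolored E ω v} → Finset ι)
      (E' : {v // Uncolored E ω v} × Fin l' → {v // Uncolored E ω v} × Fin l' → Prop),
      IsCover I' E' C d' → CoverColorable E') : CoverColorable E := by
  have hex : ∀ v, ∃ e : Fin l' ↪ Fin l, ∀ c, e c ∈ newList E ω v := fun v => by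
    obtain ⟨s, hs, hcard⟩ := Finset.exists_subset_card_eq (hl v)
    exact ⟨(s.orderEmbOfFin hcard).toEmbedding, fun c => hs (s.orderEmbOfFin_mem hcard c)⟩
  choose e he using hex
  let f : {v // Uncolored E ω v} × Fin l' → V × Fin l := fun a => (a.1.1, e a.1.1 a.2)
  have hf : Function.Injective f := by
    rintro ⟨⟨u, hu⟩, c⟩ ⟨⟨v, hv⟩, c'⟩ huv
    simp only [f, Prod.mk.injEq] at huv
    obtain ⟨rfl, huv⟩ := huv
    rw [(e u).injective huv]
  have hcov : IsCover (fun v : {v // Uncolored E ω v} => I v.1) (fun a b => E (f a) (f b)) C d' := by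
    refine ⟨fun v => h.card_le _, fun u v i j huv => h.unique _ _ i j fun hc => huv (Subtype.ext hc),
      fun a b => h.symm _ _, fun a b hab hc => h.ne _ _ hab (congrArg Subtype.val hc),
      fun a b hab => h.common _ _ hab, fun a b b' hab hab' hbb => ?_, fun a i hi => ?_⟩
    · exact hf (h.matching _ _ _ hab hab' (congrArg Subtype.val hbb))
    · refine le_trans ?_ (hd (f a) i hi)
      rw [← Set.ncard_coe_finset]
      refine Set.ncard_le_ncard_of_injOn f ?_ hf.injOn (Finset.finite_toSet _)
      rintro b ⟨hb1, hb2⟩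
      exact Finset.mem_coe.2 (Finset.mem_filter.2 ⟨mem_nbrIn.2 ⟨hb1, hb2⟩, b.1.2, he _ _⟩)
  obtain ⟨ψ, hψ⟩ := hrec _ _ hcov
  have hcol : ∀ v, ∃ x, (ω (v, none) = some x ∧ ¬ KilledEarly E ω (v, x)) ∨
      ∃ hv : Uncolored E ω v, x = e v (ψ ⟨v, hv⟩) := by
    intro v
    by_cases hv : Uncolored E ω v
    · exact ⟨_, Or.inr ⟨hv, rfl⟩⟩
    · simp only [Uncolored, not_forall] at hv
      obtain ⟨x, hx, hx'⟩ := hv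
      exact ⟨x, Or.inl ⟨hx, hx'⟩⟩
  choose φ hφ using hcol
  refine ⟨φ, fun u v huv => ?_⟩
  rcases hφ u with ⟨hu1, hu2⟩ | ⟨hu, hu'⟩ <;> rcases hφ v with ⟨hv1, hv2⟩ | ⟨hv, hv'⟩
  · rcases lt_trichotomy u v with hlt | heq | hlt
    · exact hv2 ⟨(u, φ u), h.symm _ _ huv, hlt, hu1⟩
    · exact h.ne _ _ huv heq
    · exact hu2 ⟨(v, φ v), huv, hlt, hv1⟩
  · have := he v (ψ ⟨v, hv⟩)
    rw [← hv'] at this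
    exact (Finset.mem_filter.1 this).2.2 (u, φ u) (h.symm _ _ huv) hu1
  · have := he u (ψ ⟨u, hu⟩)
    rw [← hu'] at this
    exact (Finset.mem_filter.1 this).2.2 (v, φ v) huv hv1
  · rw [hu', hv'] at huv
    exact hψ ⟨u, hu⟩ ⟨v, hv⟩ huv

end Round

end Cover

/-! ### The distribution of a round, its expectations and its bounded effects. -/

section Cover

open Classical

variable {V ι : Type*} {l : ℕ} [Fintype V] [LinearOrder V]
variable {I : V → Finset ι} {E : V × Fin l → V × Fin l → Prop} {C d : ℕ}

/-- The probability that the coin flip at the pair `a` does not discard its color. -/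
noncomputable def keepProb (E : V × Fin l → V × Fin l → Prop) (p : ℝ) (N : ℕ) (a : V × Fin l) : ℝ :=
  (1 - p / l) ^ (N - (nbr E a).card)

/-- The distributions of the tentative colors and of the coin flips. -/
noncomputable def roundDist (E : V × Fin l → V × Fin l → Prop) (p : ℝ) (N : ℕ) :
    V × Option (Fin l) → Option (Fin l) → ℝ
  | (_, none), none => 1 - p
  | (_, none), some _ => p / l
  | (v, some c), none => keepProb E p N (v, c)
  | (v, some c), some y => if y = c then 1 - keepProb E p N (v, c) else 0

/-- The values that have to be avoided for the color of `b` to survive its own coin flip and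
the tentative colors in `X`. -/
noncomputable def forbid (b : V × Fin l) (X : Finset (V × Fin l)) :
    Finset ((V × Option (Fin l)) × Option (Fin l)) :=
  insert ((b.1, some b.2), some b.2) (X.image fun w => ((w.1, none), some w.2))

section Forbid

omit [Fintype V]

lemma forall_mem_forbid {b : V × Fin l} {X : Finset (V × Fin l)} {ω : Outcome V l} :
    (∀ r ∈ forbid b X, ω r.1 ≠ r.2) ↔
      ω (b.1, some b.2) ≠ some b.2 ∧ ∀ w ∈ X, ω (w.1, none) ≠ some w.2 := by
  simp only [forbid, Finset.forall_mem_insert, Finset.forall_mem_image]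

lemma mem_forbid_vertex {b : V × Fin l} {X : Finset (V × Fin l)} {w : V} {y : Fin l} :
    ((w, none), some y) ∈ forbid b X ↔ (w, y) ∈ X := by
  simp [forbid]

lemma mem_forbid_coin {b : V × Fin l} {X : Finset (V × Fin l)} {w : V} {c : Fin l}
    {o : Option (Fin l)} : ((w, some c), o) ∈ forbid b X ↔ (w, c) = b ∧ o = some c := by
  rcases b with ⟨b1, b2⟩
  simp only [forbid, Finset.mem_insert, Prod.mk.injEq, Option.some.injEq, Finset.mem_image,
    reduceCtorEq, and_false, false_and, exists_false, or_false]
  constructor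
  · rintro ⟨⟨rfl, rfl⟩, rfl⟩; simp
  · rintro ⟨⟨rfl, rfl⟩, rfl⟩; simp

lemma none_notMem_forbid {b : V × Fin l} {X : Finset (V × Fin l)} (i : V × Option (Fin l)) :
    (i, none) ∉ forbid b X := by
  simp [forbid]

end Forbid

omit [LinearOrder V] in
lemma keepProb_mem {p : ℝ} (hp0 : 0 ≤ p) (hp1 : p ≤ 1) (N : ℕ) (a : V × Fin l) :
    0 ≤ keepProb E p N a ∧ keepProb E p N a ≤ 1 := by
  have hl : (1 : ℝ) ≤ l := by exact_mod_cast (Fin.pos a.2)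
  have h1 : p / l ≤ 1 := div_le_one_of_le₀ (hp1.trans hl) (by positivity)
  have h2 : 0 ≤ p / l := by positivity
  exact ⟨pow_nonneg (by linarith) _, pow_le_one₀ (by linarith) (by linarith)⟩

omit [LinearOrder V] in
lemma isProbFamily_roundDist {p : ℝ} (hp0 : 0 ≤ p) (hp1 : p ≤ 1) (hl : 0 < l) (N : ℕ) :
    IsProbFamily (roundDist E p N) := by
  have hl' : (0 : ℝ) < l := by exact_mod_cast hl
  constructor
  · rintro ⟨v, _ | c⟩ (_ | y)
    · simpa [roundDist] using hp1
    · simp only [roundDist]; positivity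
    · exact (keepProb_mem hp0 hp1 N (v, c)).1
    · simp only [roundDist]
      split_ifs
      · linarith [(keepProb_mem (E := E) hp0 hp1 N (v, c)).2]
      · exact le_rfl
  · rintro ⟨v, _ | c⟩
    · rw [Fintype.sum_option]
      simp only [roundDist, Finset.sum_const, Finset.card_univ, Fintype.card_fin, nsmul_eq_mul]
      field_simp
      ring
    · rw [Fintype.sum_option]
      simp [roundDist]

/-- The probability that the color of `b` survives. -/
lemma expect_forbid {p : ℝ} (hμ : IsProbFamily (roundDist E p (C * d))) (b : V × Fin l)
    (X : Finset (V × Fin l)) :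
    expect (roundDist E p (C * d)) (fun ω => if ∀ r ∈ forbid b X, ω r.1 ≠ r.2 then 1 else 0) =
      keepProb E p (C * d) b * ∏ w : V, (1 - p / l * ({y | (w, y) ∈ X} : Finset (Fin l)).card) := by
  rw [expect_avoid hμ, Fintype.prod_prod_type]
  have hv : ∀ w : V, ∏ o : Option (Fin l), (1 - ∑ x with ((w, o), x) ∈ forbid b X,
      roundDist E p (C * d) (w, o) x) =
      (if w = b.1 then keepProb E p (C * d) b else 1) *
        (1 - p / l * ({y | (w, y) ∈ X} : Finset (Fin l)).card) := by
    intro w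
    rw [Fintype.prod_option, mul_comm]
    congr 1
    · have hc : ∀ c : Fin l, (1 - ∑ x with ((w, some c), x) ∈ forbid b X,
          roundDist E p (C * d) (w, some c) x) =
          if (w, c) = b then keepProb E p (C * d) b else 1 := by
        intro c
        simp only [mem_forbid_coin]
        by_cases hb : (w, c) = b
        · simp [hb, Finset.filter_eq', roundDist]
        · simp [hb]
      simp only [hc]
      by_cases hw : w = b.1
      · rw [if_pos hw, Finset.prod_eq_single b.2]
        · simp [hw]
        · intro c _ hcb
          exact if_neg fun hh => hcb (by rw [← hh])
        · simp
      · rw [if_neg hw]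
        exact Finset.prod_eq_one fun c _ => if_neg fun hh => hw (by rw [← hh])
    · congr 1
      rw [Finset.sum_filter, Fintype.sum_option]
      simp only [none_notMem_forbid, mem_forbid_vertex, if_false, zero_add, roundDist]
      rw [← Finset.sum_filter, Finset.sum_const, nsmul_eq_mul, mul_comm]
  simp only [hv]
  rw [Finset.prod_mul_distrib]
  congr 1
  simp

lemma prod_one_sub_pow (q : ℝ) (Y : Finset (V × Fin l)) :
    ∏ w : V, (1 - q) ^ ({y | (w, y) ∈ Y} : Finset (Fin l)).card = (1 - q) ^ Y.card := by
  rw [Finset.prod_pow_eq_pow_sum]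
  congr 1
  rw [Finset.card_eq_sum_card_fiberwise (f := Prod.fst) (t := Finset.univ) (by simp)]
  refine Finset.sum_congr rfl fun w _ => ?_
  refine Finset.card_bij (fun y _ => (w, y)) (by simp) (by simp) ?_
  rintro ⟨w', y⟩ hb
  simp only [Finset.mem_filter] at hb
  obtain ⟨hb, rfl⟩ := hb
  exact ⟨y, by simpa using hb, rfl⟩

-- A matching leaves at most one conflicting color at each vertex, and `1 - q * k = (1 - q) ^ k` for
-- `k ≤ 1`.
omit [Fintype V] in
lemma one_sub_mul_card_fiber {q : ℝ} {Y : Finset (V × Fin l)} {w : V}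
    (hY : ∀ y y', (w, y) ∈ Y → (w, y') ∈ Y → y = y') :
    1 - q * ({y | (w, y) ∈ Y} : Finset (Fin l)).card =
      (1 - q) ^ ({y | (w, y) ∈ Y} : Finset (Fin l)).card := by
  have : ({y | (w, y) ∈ Y} : Finset (Fin l)).card ≤ 1 := by
    rw [Finset.card_le_one]
    simpa using fun y hy y' hy' => hY y y' hy hy'
  interval_cases ({y | (w, y) ∈ Y} : Finset (Fin l)).card <;> simp

/-- The probability that a color remains in the list. -/
lemma IsCover.expect_newList (h : IsCover I E C d) {p : ℝ}
    (hμ : IsProbFamily (roundDist E p (C * d))) (b : V × Fin l) :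
    expect (roundDist E p (C * d))
      (fun ω => if ∀ r ∈ forbid b (nbr E b), ω r.1 ≠ r.2 then 1 else 0) =
      (1 - p / l) ^ (C * d) := by
  -- The exponent in `keepProb` complements the number of conflicts to `C * d`, so the result does
  -- not depend on `b`.
  rw [expect_forbid hμ, Finset.prod_congr rfl fun w _ => one_sub_mul_card_fiber fun y y' hy hy' => ?_,
    prod_one_sub_pow, keepProb, ← pow_add]
  · congr 1
    have := h.card_nbr_le b
    omega
  · rw [mem_nbr] at hy hy'
    have := h.matching _ _ _ hy hy' rfl
    simpa using this

/-- The conflicts of `b` outside the graph with index `i`, and all colors at the vertex of `b`. -/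
noncomputable def outerNbr (I : V → Finset ι) (E : V × Fin l → V × Fin l → Prop) (i : ι)
    (b : V × Fin l) : Finset (V × Fin l) :=
  (nbr E b \ nbrIn I E i b) ∪ Finset.univ.image fun y => (b.1, y)

lemma mem_outerNbr {i : ι} {b w : V × Fin l} :
    w ∈ outerNbr I E i b ↔ (E b w ∧ i ∉ I w.1) ∨ w.1 = b.1 := by
  rcases w with ⟨w, y⟩
  simp only [outerNbr, Finset.mem_union, Finset.mem_sdiff, mem_nbr, mem_nbrIn, Finset.mem_image,
    Finset.mem_univ, true_and, Prod.mk.injEq]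
  constructor
  · rintro (⟨h1, h2⟩ | ⟨_, h1, _⟩)
    · exact Or.inl ⟨h1, fun h => h2 ⟨h1, h⟩⟩
    · exact Or.inr h1.symm
  · rintro (⟨h1, h2⟩ | h1)
    · exact Or.inl ⟨h1, fun h => h2 h.2⟩
    · exact Or.inr ⟨y, h1.symm, rfl⟩

/-- The probability that `b` receives no tentative color and that its color survives the conflicts
outside the graph with index `i`. -/
lemma IsCover.expect_outerNbr_le (h : IsCover I E C d) {p : ℝ} (hp0 : 0 ≤ p) (hp1 : p ≤ 1)
    (hl : 0 < l) {i : ι} (b : V × Fin l) (hi : i ∈ I b.1) :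
    expect (roundDist E p (C * d))
      (fun ω => if ∀ r ∈ forbid b (outerNbr I E i b), ω r.1 ≠ r.2 then 1 else 0) ≤
      (1 - p) * (1 - p / l) ^ ((C - 1) * d) := by
  have hl' : (1 : ℝ) ≤ l := by exact_mod_cast hl
  have hq1 : p / l ≤ 1 := div_le_one_of_le₀ (hp1.trans hl') (by positivity)
  have hq0 : 0 ≤ p / l := by positivity
  rw [expect_forbid (isProbFamily_roundDist hp0 hp1 hl _)]
  let Y := nbr E b \ nbrIn I E i b
  have hfac : ∀ w : V, 1 - p / l * ({y | (w, y) ∈ outerNbr I E i b} : Finset (Fin l)).card =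
      (if w = b.1 then 1 - p else 1) * (1 - p / l) ^ ({y | (w, y) ∈ Y} : Finset (Fin l)).card := by
    intro w
    by_cases hw : w = b.1
    · have h1 : ({y | (w, y) ∈ outerNbr I E i b} : Finset (Fin l)) = Finset.univ := by
        ext y
        simp [mem_outerNbr, hw]
      have h2 : ({y | (w, y) ∈ Y} : Finset (Fin l)) = ∅ := by
        ext y
        simp only [Y, Finset.mem_filter, Finset.mem_univ, true_and, Finset.mem_sdiff, mem_nbr,
          Finset.notMem_empty, iff_false, not_and]
        intro hE
        exact (h.ne _ _ hE hw.symm).elim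
      rw [h1, h2, if_pos hw]
      simp only [Finset.card_univ, Fintype.card_fin, Finset.card_empty, pow_zero, mul_one]
      field_simp
    · have h1 : ({y | (w, y) ∈ outerNbr I E i b} : Finset (Fin l)) =
          ({y | (w, y) ∈ Y} : Finset (Fin l)) := by
        ext y
        simp [Y, outerNbr, Ne.symm hw]
      rw [h1, if_neg hw, one_mul, one_sub_mul_card_fiber]
      intro y y' hy hy'
      simp only [Y, Finset.mem_sdiff, mem_nbr] at hy hy'
      have := h.matching _ _ _ hy.1 hy'.1 rfl
      simpa using this
  simp only [hfac]
  rw [Finset.prod_mul_distrib, prod_one_sub_pow, Finset.prod_ite_eq' Finset.univ b.1 (fun _ => 1 - p),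
    if_pos (Finset.mem_univ _), keepProb, mul_left_comm, ← pow_add]
  refine mul_le_mul_of_nonneg_left ?_ (by linarith)
  -- Coin flip and outer conflicts give the exponent `C * d` minus the number of conflicts in graph
  -- `i`, which is at most `d`.
  refine pow_le_pow_of_le_one (by linarith) (by linarith) ?_
  have h1 : Y.card = (nbr E b).card - (nbrIn I E i b).card :=
    Finset.card_sdiff_of_subset fun w hw => mem_nbr.2 (mem_nbrIn.1 hw).1
  have h2 : (nbrIn I E i b).card ≤ (nbr E b).card :=
    Finset.card_le_card fun w hw => mem_nbr.2 (mem_nbrIn.1 hw).1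
  have h3 := h.card_nbrIn_le hi
  have h4 := h.card_nbr_le b
  have h5 : (C - 1) * d = C * d - d := by rw [Nat.sub_mul, one_mul]
  omega

/-- The expected number of violated avoidance conditions for one color. -/
lemma sum_forbid_le {p : ℝ} (hp0 : 0 ≤ p) (hp1 : p ≤ 1) (N : ℕ) (b : V × Fin l)
    (X : Finset (V × Fin l)) :
    ∑ r ∈ forbid b X, roundDist E p N r.1 r.2 ≤ 1 + X.card * (p / l) := by
  rw [forbid, Finset.sum_insert (by simp), Finset.sum_image (by simp)]
  have h1 : roundDist E p N (b.1, some b.2) (some b.2) ≤ 1 := by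
    simp only [roundDist, if_true]
    linarith [(keepProb_mem (E := E) hp0 hp1 N (b.1, b.2)).1]
  have h2 : ∑ w ∈ X, roundDist E p N (w.1, none) (some w.2) = X.card * (p / l) := by
    simp [roundDist]
  linarith

/-- By the matching condition a tentative color deletes at most one color of `v`; a coin flip
concerns a single color. -/
lemma IsCover.card_newList_forbid_le (h : IsCover I E C d) (v : V)
    (i : V × Option (Fin l)) (x : Option (Fin l)) :
    ({c ∈ (Finset.univ : Finset (Fin l)) | (i, x) ∈ forbid (v, c) (nbr E (v, c))}).card ≤ 1 := by
  rw [Finset.card_le_one]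
  simp only [Finset.mem_filter, Finset.mem_univ, true_and]
  intro c hc c' hc'
  rcases i with ⟨w, _ | y⟩
  · rcases x with _ | y
    · exact (none_notMem_forbid _ hc).elim
    · rw [mem_forbid_vertex, mem_nbr] at hc hc'
      have := h.matching _ _ _ (h.symm _ _ hc) (h.symm _ _ hc') rfl
      simpa using this
  · rw [mem_forbid_coin] at hc hc'
    have := hc.1.symm.trans hc'.1
    simpa using this

/-- Near disjointness enters here. Each `b` in conflict with `(w, y)` shares with `w` some graph
`j`. If two such `b` had the same `j`, their vertices would lie together in `i` and in `j`, forcing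
`j = i`, although `w` is not in graph `i`. So at most `C` are affected through conflicts, and one
more has `w` as its own vertex. -/
lemma IsCover.card_outerNbr_forbid_le (h : IsCover I E C d) (hC : 1 ≤ C) (a : V × Fin l) {i : ι}
    (j : V × Option (Fin l)) (x : Option (Fin l)) :
    ({b ∈ nbrIn I E i a | (j, x) ∈ forbid b (outerNbr I E i b)}).card ≤ C + 1 := by
  rcases j with ⟨w, _ | c⟩
  · rcases x with _ | y
    · simp [none_notMem_forbid]
    · have hsub : ({b ∈ nbrIn I E i a | ((w, none), some y) ∈ forbid b (outerNbr I E i b)}) ⊆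
          ({b ∈ nbrIn I E i a | E b (w, y) ∧ i ∉ I w}) ∪ ({b ∈ nbrIn I E i a | w = b.1}) := by
        intro b hb
        rw [Finset.mem_filter, mem_forbid_vertex, mem_outerNbr] at hb
        rw [Finset.mem_union, Finset.mem_filter, Finset.mem_filter]
        tauto
      refine (Finset.card_le_card hsub).trans ((Finset.card_union_le _ _).trans (add_le_add ?_ ?_))
      · have hch : ∀ b : V × Fin l, ∃ j, E b (w, y) → j ∈ I b.1 ∧ j ∈ I w := by
          intro b
          by_cases hb : E b (w, y)
          · obtain ⟨j, hj⟩ := h.common _ _ hb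
            exact ⟨j, fun _ => hj⟩
          · exact ⟨i, fun hb' => (hb hb').elim⟩
        choose f hf using hch
        refine (Finset.card_le_card_of_injOn (t := I w) f ?_ ?_).trans (h.card_le w)
        · intro b hb
          exact (hf b (Finset.mem_filter.1 hb).2.1).2
        · intro b hb b' hb' hff
          simp only [Finset.coe_filter, mem_nbrIn, Set.mem_ofPred_eq] at hb hb'
          by_contra hne
          have hv : b.1 ≠ b'.1 := fun hv => hne (h.matching _ _ _ hb.1.1 hb'.1.1 hv)
          have hj := h.unique _ _ i (f b) hv hb.1.2 hb'.1.2 (hf b hb.2.1).1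
            (hff ▸ (hf b' hb'.2.1).1)
          exact hb.2.2 (hj ▸ (hf b hb.2.1).2)
      · rw [Finset.card_le_one]
        intro b hb b' hb'
        simp only [Finset.mem_filter, mem_nbrIn] at hb hb'
        exact h.matching _ _ _ hb.1.1 hb'.1.1 (hb.2.symm.trans hb'.2)
  · refine le_trans ?_ (by omega : 1 ≤ C + 1)
    rw [Finset.card_le_one]
    intro b hb b' hb'
    rw [Finset.mem_filter, mem_forbid_coin] at hb hb'
    exact hb.2.1.symm.trans hb'.2.1

lemma card_newList (ω : Outcome V l) (v : V) :
    ((newList E ω v).card : ℝ) =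
      avoidCount Finset.univ (fun c => forbid (v, c) (nbr E (v, c))) ω := by
  rw [avoidCount, newList, Finset.card_filter]
  push_cast
  simp only [forall_mem_forbid, mem_nbr]

/-- The indicator of the event that `u` has a tentative color that is in conflict with
an earlier vertex, while at most `M` colors of `u` have such a conflict. -/
noncomputable def lossInd (E : V × Fin l → V × Fin l → Prop) (M : ℝ) (u : V) (ω : Outcome V l) :
    ℝ :=
  if (∃ x, ω (u, none) = some x ∧ KilledEarly E ω (u, x)) ∧
    (({x | KilledEarly E ω (u, x)} : Finset (Fin l)).card : ℝ) ≤ M then 1 else 0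

omit [Fintype V] in
lemma killedEarly_congr {ω ω' : Outcome V l} {a : V × Fin l}
    (h : ∀ b, E a b → b.1 < a.1 → ω (b.1, none) = ω' (b.1, none)) :
    KilledEarly E ω a ↔ KilledEarly E ω' a := by
  refine exists_congr fun b => and_congr_right fun hb => and_congr_right fun hlt => ?_
  rw [h b hb hlt]

omit [Fintype V] in
lemma killedEarly_update {ω : Outcome V l} {a : V × Fin l} {v : V} (hv : ¬ v < a.1)
    (x : Option (Fin l)) : KilledEarly E (update ω (v, none) x) a ↔ KilledEarly E ω a := by
  refine killedEarly_congr fun b _ hlt => update_of_ne ?_ _ _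
  rintro hb
  simp only [Prod.mk.injEq, and_true] at hb
  exact hv (hb ▸ hlt)

omit [Fintype V] in
lemma lossInd_congr {M : ℝ} {u : V} {ω ω' : Outcome V l} (hu : ω (u, none) = ω' (u, none))
    (h : ∀ c b, E (u, c) b → b.1 < u → ω (b.1, none) = ω' (b.1, none)) :
    lossInd E M u ω = lossInd E M u ω' := by
  have : ∀ x, KilledEarly E ω (u, x) ↔ KilledEarly E ω' (u, x) :=
    fun x => killedEarly_congr fun b hb hlt => h x b hb hlt
  simp only [lossInd, this, hu]

omit [Fintype V] in
lemma lossInd_zero_or_one (M : ℝ) (u : V) (ω : Outcome V l) :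
    lossInd E M u ω = 0 ∨ lossInd E M u ω = 1 := by
  rw [lossInd]
  split_ifs <;> simp

/-- The colors killed at `u` are determined by earlier vertices, so resampling the tentative color
of `u` hits them with probability `p / l` each; the truncation leaves at most `M` of them. -/
lemma avg_lossInd_le {p : ℝ} (hp0 : 0 ≤ p) (N : ℕ) {M : ℝ} (hM : 0 ≤ M) (u : V)
    (ω : Outcome V l) : avg (roundDist E p N) (u, none) (lossInd E M u) ω ≤ p / l * M := by
  have hq : 0 ≤ p / l := by positivity
  let F : Finset (Fin l) := {x | KilledEarly E ω (u, x)}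
  have hX : ∀ x, lossInd E M u (update ω (u, none) x) =
      if (∃ y, x = some y ∧ KilledEarly E ω (u, y)) ∧ (F.card : ℝ) ≤ M then 1 else 0 := by
    intro x
    have hk : ∀ y, KilledEarly E (update ω (u, none) x) (u, y) ↔ KilledEarly E ω (u, y) :=
      fun y => killedEarly_update (a := (u, y)) (lt_irrefl u) x
    simp only [lossInd, update_self, hk, F]
  rw [avg, Fintype.sum_option]
  simp only [hX]
  by_cases hF : (F.card : ℝ) ≤ M
  · have : ∀ y : Fin l, roundDist E p N (u, none) (some y) *
        (if (∃ y', some y = some y' ∧ KilledEarly E ω (u, y')) ∧ (F.card : ℝ) ≤ M then 1 else 0) =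
        if y ∈ F then p / l else 0 := by
      intro y
      simp [roundDist, hF, F]
    simp only [this]
    rw [← Finset.sum_filter]
    simp only [reduceCtorEq, false_and, exists_false, if_false, mul_zero, zero_add,
      Finset.sum_const, nsmul_eq_mul, Finset.filter_mem_eq_inter, Finset.univ_inter]
    rw [mul_comm]
    exact mul_le_mul_of_nonneg_left hF hq
  · simp only [hF, and_false, if_false, mul_zero, Finset.sum_const_zero, add_zero]
    positivity

/-- The surviving conflicts are counted by two quantities whose tails can be bounded. -/
lemma card_newNbrIn_le (h : IsCover I E C d) {M : ℝ} (ω : Outcome V l)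
    (hM : ∀ u, ((l : ℝ) - (newList E ω u).card) ≤ M) (i : ι) (a : V × Fin l) :
    ((newNbrIn I E ω i a).card : ℝ) ≤
      avoidCount (nbrIn I E i a) (fun b => forbid b (outerNbr I E i b)) ω +
        ∑ u ∈ (nbrIn I E i a).image Prod.fst, lossInd E M u ω := by
  rw [Finset.sum_image, avoidCount, ← Finset.sum_add_distrib, newNbrIn, Finset.card_filter]
  · push_cast
    refine Finset.sum_le_sum fun b _ => ?_
    have h0 : 0 ≤ lossInd E M b.1 ω := by
      rcases lossInd_zero_or_one (E := E) M b.1 ω with h | h <;> simp [h]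
    have h0' : (0 : ℝ) ≤ if ∀ r ∈ forbid b (outerNbr I E i b), ω r.1 ≠ r.2 then 1 else 0 := by
      split_ifs <;> simp
    by_cases hb : Uncolored E ω b.1 ∧ b.2 ∈ newList E ω b.1
    swap
    · rw [if_neg hb]
      exact add_nonneg h0' h0
    rw [if_pos hb]
    obtain ⟨hunc, hlist⟩ := hb
    -- Without a tentative color, `b` is counted by the first quantity. With one, that color was
    -- killed, and the truncation in `lossInd` holds because killed colors are missing from the new
    -- list.
    rcases hω : ω (b.1, none) with _ | x
    · rw [if_pos]
      · linarith
      · rw [forall_mem_forbid]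
        have hl := (Finset.mem_filter.1 hlist).2
        refine ⟨hl.1, fun w hw => ?_⟩
        rcases mem_outerNbr.1 hw with hw | hw
        · exact hl.2 w hw.1
        · rw [hw, hω]
          simp
    · have : lossInd E M b.1 ω = 1 := by
        rw [lossInd, if_pos]
        refine ⟨⟨x, hω, hunc x hω⟩, le_trans ?_ (hM b.1)⟩
        rw [le_sub_iff_add_le]
        have hdisj : Disjoint ({x | KilledEarly E ω (b.1, x)} : Finset (Fin l))
            (newList E ω b.1) := by
          rw [Finset.disjoint_left]
          intro c hc hc'
          simp only [Finset.mem_filter, Finset.mem_univ, true_and] at hc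
          obtain ⟨w, hw1, -, hw2⟩ := hc
          exact (Finset.mem_filter.1 hc').2.2 w hw1 hw2
        have := Finset.card_le_univ (({x | KilledEarly E ω (b.1, x)} : Finset (Fin l)) ∪
          (newList E ω b.1))
        rw [Finset.card_union_of_disjoint hdisj, Fintype.card_fin] at this
        exact_mod_cast this
      linarith
  · intro b hb b' hb' hbb
    simp only [Finset.mem_coe, mem_nbrIn] at hb hb'
    exact h.matching _ _ _ hb.1 hb'.1 hbb

end Cover

/-! ### Locality of the bad events and existence of a good round. -/

section Cover

open Classical

variable {V ι : Type*} {l : ℕ} [Fintype V]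
variable {I : V → Finset ι} {E : V × Fin l → V × Fin l → Prop} {C d : ℕ}

/-- The vertices at distance at most two from `v`. -/
noncomputable def secondNbhd (E : V × Fin l → V × Fin l → Prop) (v : V) : Finset V :=
  (closedNbhd E v).biUnion (closedNbhd E)

lemma mem_secondNbhd {u v w : V} (h1 : u ∈ closedNbhd E v) (h2 : w ∈ closedNbhd E u) :
    w ∈ secondNbhd E v :=
  Finset.mem_biUnion.2 ⟨u, h1, h2⟩

lemma closedNbhd_subset_secondNbhd (v : V) : closedNbhd E v ⊆ secondNbhd E v :=
  fun _ hu => mem_secondNbhd (self_mem_closedNbhd v) hu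

lemma IsCover.mem_secondNbhd_comm (h : IsCover I E C d) {u v : V} (huv : u ∈ secondNbhd E v) :
    v ∈ secondNbhd E u := by
  obtain ⟨w, hw1, hw2⟩ := Finset.mem_biUnion.1 huv
  exact mem_secondNbhd (h.mem_closedNbhd_comm hw2) (h.mem_closedNbhd_comm hw1)

/-- A bad event at a vertex depends on coordinates within distance two, so it interacts only with
events within distance four. -/
lemma IsCover.card_secondNbhd_biUnion_le (h : IsCover I E C d) (v : V) :
    ((secondNbhd E v).biUnion (secondNbhd E)).card ≤ (l * (C * d) + 1) ^ 4 := by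
  have h2 : ∀ u, (secondNbhd E u).card ≤ (l * (C * d) + 1) * (l * (C * d) + 1) := fun u =>
    (Finset.card_biUnion_le_card_mul _ _ _ fun w _ => h.card_closedNbhd_le w).trans
      (Nat.mul_le_mul_right _ (h.card_closedNbhd_le u))
  refine (Finset.card_biUnion_le_card_mul _ _ _ fun w _ => h2 w).trans
    ((Nat.mul_le_mul_right _ (h2 v)).trans (le_of_eq (by ring)))

variable [LinearOrder V]

omit [LinearOrder V] in
lemma newList_congr {v : V} {ω ω' : Outcome V l}
    (hω : ∀ u ∈ closedNbhd E v, ∀ o, ω (u, o) = ω' (u, o)) :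
    newList E ω v = newList E ω' v := by
  refine Finset.filter_congr fun c _ => ?_
  rw [hω v (self_mem_closedNbhd v)]
  refine and_congr_right fun _ => forall₂_congr fun b hb => ?_
  rw [hω b.1 (mem_closedNbhd_of_conflict hb)]

/-- The event that one of the quantities at `v` that control the round is far from its mean. -/
def badEvent (I : V → Finset ι) (E : V × Fin l → V × Fin l → Prop) (x y z M : ℝ) (v : V) :
    Set (Outcome V l) :=
  {ω | ((newList E ω v).card : ℝ) ≤ x} ∪ ⋃ i ∈ I v, ⋃ c ∈ (Finset.univ : Finset (Fin l)),
    ({ω | y ≤ avoidCount (nbrIn I E i (v, c)) (fun b => forbid b (outerNbr I E i b)) ω} ∪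
      {ω | z ≤ ∑ u ∈ (nbrIn I E i (v, c)).image Prod.fst, lossInd E M u ω})

lemma dependsOn_badEvent (x y z M : ℝ) (v : V) :
    DependsOn (· ∈ badEvent I E x y z M v)
      ((secondNbhd E v ×ˢ (Finset.univ : Finset (Option (Fin l))) :
        Finset (V × Option (Fin l))) : Set (V × Option (Fin l))) := by
  intro ω ω' hω
  have hω' : ∀ u ∈ secondNbhd E v, ∀ o, ω (u, o) = ω' (u, o) := fun u hu o =>
    hω (u, o) (by simpa using hu)
  have h1 : newList E ω v = newList E ω' v :=
    newList_congr fun u hu => hω' u (closedNbhd_subset_secondNbhd v hu)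
  have h2 : ∀ i c, avoidCount (nbrIn I E i (v, c)) (fun b => forbid b (outerNbr I E i b)) ω =
      avoidCount (nbrIn I E i (v, c)) (fun b => forbid b (outerNbr I E i b)) ω' := by
    intro i c
    refine avoidCount_congr _ _ fun b hb r hr => ?_
    have hbv : b.1 ∈ closedNbhd E v := mem_closedNbhd_of_conflict (mem_nbrIn.1 hb).1
    rw [forbid, Finset.mem_insert, Finset.mem_image] at hr
    rcases hr with rfl | ⟨w, hw, rfl⟩
    · exact hω' _ (closedNbhd_subset_secondNbhd v hbv) _
    · refine hω' _ (mem_secondNbhd hbv ?_) _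
      rcases mem_outerNbr.1 hw with hw | hw
      · exact mem_closedNbhd_of_conflict hw.1
      · rw [hw]
        exact self_mem_closedNbhd _
  have h3 : ∀ i c, ∑ u ∈ (nbrIn I E i (v, c)).image Prod.fst, lossInd E M u ω =
      ∑ u ∈ (nbrIn I E i (v, c)).image Prod.fst, lossInd E M u ω' := by
    intro i c
    refine Finset.sum_congr rfl fun u hu => ?_
    obtain ⟨b, hb, rfl⟩ := Finset.mem_image.1 hu
    have hbv : b.1 ∈ closedNbhd E v := mem_closedNbhd_of_conflict (mem_nbrIn.1 hb).1
    exact lossInd_congr (hω' _ (closedNbhd_subset_secondNbhd v hbv) _) fun c w hw _ =>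
      hω' _ (mem_secondNbhd hbv (mem_closedNbhd.2 (Or.inr ⟨c, w.2, hw⟩))) _
  simp only [badEvent, Set.mem_union, Set.mem_iUnion, Set.mem_ofPred_eq, h1, h2, h3]

variable {p δ σ γ : ℝ}

/-- The parameter `t = τ / (2 * W)` minimizes `t ^ 2 * W * L - t * τ * L`, with minimum `-τ ^ 2 * L
/ (4 * W)`. -/
lemma tail_exponent_le {K m n W τ y L : ℝ} (hKm : K * m = W) (hW : 0 < W) (hτ : 0 ≤ τ)
    (hn : n ≤ L) (hy : τ * L ≤ y) (hL : 0 ≤ L) (hγ : γ * (4 * W) ≤ τ ^ 2) :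
    (τ / (2 * W)) ^ 2 * (K * (m * n)) - τ / (2 * W) * y ≤ -(γ * L) := by
  have h1 : (τ / (2 * W)) ^ 2 * (K * (m * n)) ≤ τ ^ 2 / (4 * W) * L := by
    have : (τ / (2 * W)) ^ 2 * (K * (m * n)) = τ ^ 2 / (4 * W) * n := by
      rw [← mul_assoc K, hKm]
      field_simp
      ring
    rw [this]
    exact mul_le_mul_of_nonneg_left hn (by positivity)
  have h2 : τ ^ 2 / (2 * W) * L ≤ τ / (2 * W) * y := by
    have : τ ^ 2 / (2 * W) * L = τ / (2 * W) * (τ * L) := by ring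
    rw [this]
    exact mul_le_mul_of_nonneg_left hy (by positivity)
  have h3 : γ ≤ τ ^ 2 / (4 * W) := by rwa [le_div_iff₀ (by positivity)]
  have h4 : τ ^ 2 / (2 * W) = 2 * (τ ^ 2 / (4 * W)) := by
    field_simp
    ring
  rw [h4] at h2
  nlinarith [mul_le_mul_of_nonneg_right h3 hL]

/-- Both tails of a count of surviving colors. -/
lemma prob_avoidCount_forbid_le {A : Type*} (hp0 : 0 < p) (hp1 : p ≤ 1) (hl : 0 < l) (M : ℕ)
    {τ y Y : ℝ} (hτ0 : 0 ≤ τ) (hτ1 : τ ≤ 1) (hγ : γ * (4 * ((C + 1) * (C + 2))) ≤ τ ^ 2)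
    (N : Finset A) (β : A → V × Fin l) (X : A → Finset (V × Fin l)) (hN : N.card ≤ l)
    (hX : ∀ a, (X a).card ≤ (C + 1) * l)
    (hK : ∀ i x, ({a ∈ N | (i, x) ∈ forbid (β a) (X a)}).card ≤ C + 1) (hy : τ * l ≤ y) :
    (expect (roundDist E p M) (avoidCount N fun a => forbid (β a) (X a)) ≤ Y →
      prob (roundDist E p M) {ω | Y + y ≤ avoidCount N (fun a => forbid (β a) (X a)) ω} ≤
        Real.exp (-(γ * l))) ∧
    (Y ≤ expect (roundDist E p M) (avoidCount N fun a => forbid (β a) (X a)) →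
      prob (roundDist E p M) {ω | avoidCount N (fun a => forbid (β a) (X a)) ω ≤ Y - y} ≤
        Real.exp (-(γ * l))) := by
  have hμ := isProbFamily_roundDist (E := E) hp0.le hp1 hl M
  have hl' : (0 : ℝ) < l := by exact_mod_cast hl
  have hm : ∀ a ∈ N, ∑ r ∈ forbid (β a) (X a), roundDist E p M r.1 r.2 ≤ (C : ℝ) + 2 := by
    intro a _
    refine (sum_forbid_le hp0.le hp1 _ _ _).trans ?_
    have h1 : ((X a).card : ℝ) ≤ (C + 1) * l := by exact_mod_cast hX a
    have h2 : ((X a).card : ℝ) * (p / l) ≤ (C + 1) * l * (p / l) :=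
      mul_le_mul_of_nonneg_right h1 (by positivity)
    have h3 : ((C : ℝ) + 1) * l * (p / l) = (C + 1) * p := by field_simp
    nlinarith [Nat.cast_nonneg (α := ℝ) C]
  have htK : τ / (2 * ((C + 1) * (C + 2))) * ((C : ℝ) + 1) ≤ 1 := by
    have : τ / (2 * ((C + 1) * (C + 2))) * ((C : ℝ) + 1) = τ / (2 * (C + 2)) := by field_simp
    rw [this]
    refine div_le_one_of_le₀ ?_ (by positivity)
    linarith [Nat.cast_nonneg (α := ℝ) C]
  have hconc := prob_avoidCount_le hμ N (fun a => forbid (β a) (X a)) (fun _ => none)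
    (fun _ _ i => none_notMem_forbid i) (C + 1) (C + 2) (τ / (2 * ((C + 1) * (C + 2)))) Y y
    (fun i x => by exact_mod_cast hK i x) (by positivity) hm (by positivity) htK
  have hexp := Real.exp_le_exp.2 (tail_exponent_le (γ := γ) (n := (N.card : ℝ)) (L := l) (y := y)
    (rfl : ((C : ℝ) + 1) * (C + 2) = _) (by positivity) hτ0 (by exact_mod_cast hN) hy hl'.le hγ)
  exact ⟨fun h => (hconc.1 h).trans hexp, fun h => (hconc.2 h).trans hexp⟩

lemma IsCover.prob_newList_le (h : IsCover I E C d) (hp0 : 0 < p) (hp1 : p ≤ 1) (hl : 0 < l)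
    {τ y : ℝ} (hτ0 : 0 ≤ τ) (hτ1 : τ ≤ 1) (hd : d ≤ l)
    (hγ : γ * (4 * ((C + 1) * (C + 2))) ≤ τ ^ 2) (hy : τ * l ≤ y) (v : V) :
    prob (roundDist E p (C * d))
      {ω | ((newList E ω v).card : ℝ) ≤ l * (1 - p / l) ^ (C * d) - y} ≤
      Real.exp (-(γ * l)) := by
  have hμ := isProbFamily_roundDist (E := E) hp0.le hp1 hl (C * d)
  simp only [card_newList]
  refine (prob_avoidCount_forbid_le hp0 hp1 hl (C * d) hτ0 hτ1 hγ Finset.univ (fun c => (v, c))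
    (fun c => nbr E (v, c)) (by simp) (fun c => ?_) (fun i x => ?_) hy).2 ?_
  · exact (h.card_nbr_le _).trans (Nat.mul_le_mul (Nat.le_succ C) hd)
  · exact (h.card_newList_forbid_le v i x).trans (by omega)
  · refine le_of_eq ?_
    unfold avoidCount
    rw [expect_sum, Finset.sum_congr rfl fun c _ => h.expect_newList hμ (v, c)]
    simp

lemma IsCover.prob_outer_le (h : IsCover I E C d) (hC : 1 ≤ C) (hp0 : 0 < p) (hp1 : p ≤ 1)
    (hl : 0 < l) {τ y Y : ℝ} (hτ0 : 0 ≤ τ) (hτ1 : τ ≤ 1) (hd : d ≤ l)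
    (hγ : γ * (4 * ((C + 1) * (C + 2))) ≤ τ ^ 2) (hy : τ * l ≤ y) {i : ι} {a : V × Fin l}
    (hi : i ∈ I a.1) (hY : d * ((1 - p) * (1 - p / l) ^ ((C - 1) * d)) ≤ Y) :
    prob (roundDist E p (C * d))
      {ω | Y + y ≤ avoidCount (nbrIn I E i a) (fun b => forbid b (outerNbr I E i b)) ω} ≤
      Real.exp (-(γ * l)) := by
  have hl' : (1 : ℝ) ≤ l := by exact_mod_cast hl
  have hcard := h.card_nbrIn_le hi
  refine (prob_avoidCount_forbid_le hp0 hp1 hl (C * d) hτ0 hτ1 hγ (nbrIn I E i a) id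
    (fun b => outerNbr I E i b) (hcard.trans hd) (fun b => ?_)
    (fun j x => h.card_outerNbr_forbid_le hC a j x) hy).1 ?_
  · refine (Finset.card_union_le _ _).trans ?_
    have h1 : (nbr E b \ nbrIn I E i b).card ≤ C * l :=
      (Finset.card_le_card Finset.sdiff_subset).trans
        ((h.card_nbr_le b).trans (Nat.mul_le_mul_left C hd))
    have h2 : ((Finset.univ : Finset (Fin l)).image fun y => (b.1, y)).card ≤ l :=
      Finset.card_image_le.trans (by simp)
    rw [add_mul, one_mul]
    exact add_le_add h1 h2
  · refine le_trans ?_ hY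
    unfold avoidCount
    rw [expect_sum]
    have hq1 : p / l ≤ 1 := div_le_one_of_le₀ (hp1.trans hl') (by positivity)
    have hnn : 0 ≤ (1 - p) * (1 - p / l) ^ ((C - 1) * d) :=
      mul_nonneg (by linarith) (pow_nonneg (by linarith) _)
    refine (Finset.sum_le_card_nsmul _ _ _ fun b hb =>
      h.expect_outerNbr_le hp0.le hp1 hl b (mem_nbrIn.1 hb).2).trans ?_
    rw [nsmul_eq_mul]
    exact mul_le_mul_of_nonneg_right (by exact_mod_cast hcard) hnn

/-- The loss at a vertex depends only on tentative colors there and at earlier vertices, so the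
ordered exponential moment bound applies. -/
lemma IsCover.prob_loss_le (h : IsCover I E C d) (hp0 : 0 < p) (hp1 : p ≤ 1) (hl : 0 < l)
    {M z : ℝ} (hM : 0 ≤ M) {i : ι} {a : V × Fin l} (hi : i ∈ I a.1)
    (hz : γ * l + 2 * (p / l * M) * d ≤ z) :
    prob (roundDist E p (C * d))
      {ω | z ≤ ∑ u ∈ (nbrIn I E i a).image Prod.fst, lossInd E M u ω} ≤ Real.exp (-(γ * l)) := by
  have hμ := isProbFamily_roundDist (E := E) hp0.le hp1 hl (C * d)
  refine (hμ.prob_le_exp_mul_expect _ _).trans ?_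
  refine (mul_le_mul_of_nonneg_left (expect_exp_sum_le_of_ordered hμ (lossInd E M)
    (fun u => (u, none)) (p / l * M) (fun u ω => avg_lossInd_le hp0.le _ hM u ω)
    (fun u ω => lossInd_zero_or_one M u ω) _ fun u _ v _ huv ω x => ?_) (Real.exp_pos _).le).trans ?_
  · refine lossInd_congr ?_ fun c b _ hb => ?_
    · refine update_of_ne ?_ _ _
      simpa using huv.ne
    · refine update_of_ne ?_ _ _
      simpa using (hb.trans huv).ne
  · rw [← Real.exp_add]
    refine Real.exp_le_exp.2 ?_
    have h1 : ((((nbrIn I E i a).image Prod.fst).card : ℕ) : ℝ) ≤ d := by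
      exact_mod_cast Finset.card_image_le.trans (h.card_nbrIn_le hi)
    have h2 : 2 * (p / l * M) * (((nbrIn I E i a).image Prod.fst).card : ℝ) ≤
        2 * (p / l * M) * d := mul_le_mul_of_nonneg_left h1 (by positivity)
    linarith

/-- With positive probability the lists stay large and the degrees become small. -/
lemma IsCover.exists_round (h : IsCover I E C d) (hC : 1 ≤ C) (hp0 : 0 < p) (hp1 : p ≤ 1)
    (hl : 0 < l) (hσ0 : 0 < σ) (hσ1 : σ ≤ 1) (hδ0 : 0 < δ) (hδ1 : δ ≤ 1) (hδC : δ ≤ C * p)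
    (hd : (d : ℝ) ≤ σ * l) (hγ1 : γ * (4 * ((C + 1) * (C + 2))) ≤ (δ * σ) ^ 2)
    (hγ2 : γ ≤ 4 * C * p ^ 2 * σ)
    (hbig : 4 * ((1 + 2 * C * l) * Real.exp (-(γ * l))) * (1 + C * (l : ℝ) ^ 2) ^ 4 ≤ 1) :
    ∃ ω : Outcome V l, (∀ v, ((1 - p / l) ^ (C * d) - δ) * l ≤ (newList E ω v).card) ∧
      ∀ a, ∀ i ∈ I a.1, ((newNbrIn I E ω i a).card : ℝ) ≤
        σ * l * ((1 - p) * (1 - p / l) ^ ((C - 1) * d) + δ + 8 * C * p ^ 2) := by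
  have hμ := isProbFamily_roundDist (E := E) hp0.le hp1 hl (C * d)
  have hl' : (1 : ℝ) ≤ l := by exact_mod_cast hl
  have hC' : (1 : ℝ) ≤ C := by exact_mod_cast hC
  have hdl : (d : ℝ) ≤ l := hd.trans (by nlinarith)
  have hdl' : d ≤ l := by exact_mod_cast hdl
  have hq0 : 0 ≤ p / l := by positivity
  have hq1 : p / l ≤ 1 := div_le_one_of_le₀ (hp1.trans hl') (by positivity)
  have hτ : δ * σ ≤ 1 := mul_le_one₀ hδ1 hσ0.le hσ1
  -- `M` bounds the expected list loss `C * p * l` plus the fluctuation `δ * l`. In `z`, half covers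
  -- twice the conditional mean of the losses and half covers `γ * l`.
  let M : ℝ := 2 * C * p * l
  let x : ℝ := l * (1 - p / l) ^ (C * d) - δ * l
  let Y : ℝ := σ * l * ((1 - p) * (1 - p / l) ^ ((C - 1) * d))
  let y : ℝ := δ * σ * l
  let z : ℝ := 8 * C * p ^ 2 * (σ * l)
  have hprob : ∀ v, prob (roundDist E p (C * d)) (badEvent I E x (Y + y) z M v) ≤
      (1 + 2 * C * l) * Real.exp (-(γ * l)) := by
    intro v
    refine (hμ.prob_union_le _ _).trans ?_
    have h1 := h.prob_newList_le (γ := γ) hp0 hp1 hl (by positivity) hτ hdl' hγ1 (y := δ * l)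
      (by nlinarith [mul_pos hδ0 (by linarith : (0 : ℝ) < l)]) v
    have h2 : ∀ i ∈ I v, ∀ c ∈ (Finset.univ : Finset (Fin l)), prob (roundDist E p (C * d))
        ({ω | Y + y ≤ avoidCount (nbrIn I E i (v, c)) (fun b => forbid b (outerNbr I E i b)) ω} ∪
        {ω | z ≤ ∑ u ∈ (nbrIn I E i (v, c)).image Prod.fst, lossInd E M u ω}) ≤
        2 * Real.exp (-(γ * l)) := by
      intro i hi c _
      refine (hμ.prob_union_le _ _).trans ?_
      have h3 := h.prob_outer_le (γ := γ) hC hp0 hp1 hl (by positivity) hτ hdl' hγ1 (y := y)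
        (Y := Y) le_rfl (a := (v, c)) hi (mul_le_mul_of_nonneg_right hd
          (mul_nonneg (by linarith) (pow_nonneg (by linarith) _)))
      have h4 := h.prob_loss_le (γ := γ) hp0 hp1 hl (M := M) (z := z) (by positivity)
        (a := (v, c)) hi (by
          have e1 : p / l * M = 2 * C * p ^ 2 := by
            simp only [M]
            field_simp
          rw [e1]
          simp only [z]
          have e2 : γ * l ≤ 4 * C * p ^ 2 * σ * l :=
            mul_le_mul_of_nonneg_right hγ2 (by positivity)
          have e3 : 2 * (2 * C * p ^ 2) * d ≤ 2 * (2 * C * p ^ 2) * (σ * l) :=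
            mul_le_mul_of_nonneg_left hd (by positivity)
          linarith)
      linarith
    have h5 : prob (roundDist E p (C * d)) (⋃ i ∈ I v, ⋃ c ∈ (Finset.univ : Finset (Fin l)),
        ({ω | Y + y ≤ avoidCount (nbrIn I E i (v, c)) (fun b => forbid b (outerNbr I E i b)) ω} ∪
        {ω | z ≤ ∑ u ∈ (nbrIn I E i (v, c)).image Prod.fst, lossInd E M u ω})) ≤
        C * (l * (2 * Real.exp (-(γ * l)))) := by
      refine (hμ.prob_biUnion_le _ _).trans ?_
      calc _ ≤ ∑ i ∈ I v, (l : ℝ) * (2 * Real.exp (-(γ * l))) := by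
            refine Finset.sum_le_sum fun i hi => (hμ.prob_biUnion_le _ _).trans ?_
            refine (Finset.sum_le_card_nsmul _ _ _ (h2 i hi)).trans (le_of_eq ?_)
            simp
        _ = (I v).card * (l * (2 * Real.exp (-(γ * l)))) := by
            rw [Finset.sum_const, nsmul_eq_mul]
        _ ≤ _ := mul_le_mul_of_nonneg_right (by exact_mod_cast h.card_le v) (by positivity)
    refine (add_le_add h1 h5).trans (le_of_eq (by ring))
  have hcount : ∀ v, (({k : V | ¬ Disjoint (secondNbhd E v ×ˢ (Finset.univ : Finset (Option (Fin l))))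
      (secondNbhd E k ×ˢ (Finset.univ : Finset (Option (Fin l))))}.ncard : ℕ) : ℝ) ≤
      (1 + C * (l : ℝ) ^ 2) ^ 4 := by
    intro v
    have h1 : {k : V | ¬ Disjoint (secondNbhd E v ×ˢ (Finset.univ : Finset (Option (Fin l))))
        (secondNbhd E k ×ˢ (Finset.univ : Finset (Option (Fin l))))}.ncard ≤
        (l * (C * d) + 1) ^ 4 := by
      refine le_trans ?_ (h.card_secondNbhd_biUnion_le v)
      rw [← Set.ncard_coe_finset]
      refine Set.ncard_le_ncard (fun k hk => ?_) (Finset.finite_toSet _)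
      rw [Set.mem_ofPred_eq, Finset.not_disjoint_iff] at hk
      obtain ⟨⟨w, o⟩, hw1, hw2⟩ := hk
      rw [Finset.mem_product] at hw1 hw2
      simp only [Finset.coe_biUnion, Set.mem_iUnion]
      exact ⟨w, hw1.1, h.mem_secondNbhd_comm hw2.1⟩
    have h2 : (l : ℝ) * (C * d) + 1 ≤ 1 + C * (l : ℝ) ^ 2 := by
      have : (l : ℝ) * (C * d) ≤ l * (C * l) := by gcongr
      linarith
    calc _ ≤ (((l * (C * d) + 1) ^ 4 : ℕ) : ℝ) := by exact_mod_cast h1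
      _ = ((l : ℝ) * (C * d) + 1) ^ 4 := by push_cast; ring
      _ ≤ _ := pow_le_pow_left₀ (by positivity) h2 4
  obtain ⟨ω, hω⟩ := exists_forall_notMem_of_local hμ (badEvent I E x (Y + y) z M) _
    (dependsOn_badEvent x (Y + y) z M) _ _ hprob
    (one_le_pow₀ (le_add_of_nonneg_right (by positivity))) hcount hbig
  simp only [badEvent, Set.mem_union, Set.mem_iUnion, Set.mem_ofPred_eq, not_or, not_exists,
    not_le] at hω
  have hlist : ∀ v, x ≤ (newList E ω v).card := fun v => (hω v).1.le
  refine ⟨ω, fun v => (le_of_eq (by simp only [x]; ring)).trans (hlist v), fun a i hi => ?_⟩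
  -- As no list is too short anywhere, the truncation built into `lossInd` is harmless for this
  -- outcome; it served only to keep the bad events local.
  have hM : ∀ u, (l : ℝ) - (newList E ω u).card ≤ M := by
    intro u
    have hb : 1 - (C * d : ℝ) * (p / l) ≤ (1 - p / l) ^ (C * d) := by
      have := one_add_mul_le_pow (a := -(p / l)) (by linarith) (C * d)
      push_cast at this
      rw [← sub_eq_add_neg] at this
      linarith
    have h1 : (C * d : ℝ) * (p / l) ≤ C * p := by
      have : (C * d : ℝ) * (p / l) = C * p * (d / l) := by ring
      rw [this]
      exact mul_le_of_le_one_right (by positivity) (div_le_one_of_le₀ hdl (by positivity))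
    have h2 : (1 - C * p - δ) * l ≤ ((1 - p / l) ^ (C * d) - δ) * l :=
      mul_le_mul_of_nonneg_right (by linarith) (by positivity)
    have h3 : δ * l ≤ C * p * l := mul_le_mul_of_nonneg_right hδC (by positivity)
    have h4 := hlist u
    simp only [x] at h4
    simp only [M]
    linarith
  have h5 := card_newNbrIn_le h ω hM i a
  have h6 := (hω a.1).2 i hi a.2 (Finset.mem_univ _)
  have h7 := h6.1
  have h8 := h6.2
  simp only [Y, y, z] at h7 h8
  rw [Prod.mk.eta] at h7 h8
  linarith

end Cover

-- Iterating rounds until the ratio of degree to list size is small.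

universe u v

/-- For all large `l`, covers with `l` colors per vertex and degrees at most `s * l` in each of
the graphs are colorable. -/
def ColorableRatio (C : ℕ) (s : ℝ) : Prop :=
  ∃ l₀ : ℕ, ∀ l : ℕ, l₀ ≤ l → ∀ (V : Type u) (ι : Type v) [Fintype V] (I : V → Finset ι)
    (E : V × Fin l → V × Fin l → Prop) (d : ℕ), IsCover I E C d → (d : ℝ) ≤ s * l →
      CoverColorable E

/-- The local lemma condition: the polynomial factors have total degree `1 + 2 * 4 = 9` in `l` and
lose to the exponential. -/
lemma exists_forall_exp_le (C : ℕ) (hC : 1 ≤ C) {γ : ℝ} (hγ : 0 < γ) :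
    ∃ l₁ : ℕ, ∀ l : ℕ, l₁ ≤ l →
      4 * ((1 + 2 * C * l) * Real.exp (-(γ * l))) * (1 + C * (l : ℝ) ^ 2) ^ 4 ≤ 1 := by
  have hC' : (1 : ℝ) ≤ C := by exact_mod_cast hC
  have hlim : Filter.Tendsto (fun l : ℕ => (γ * (l : ℝ)) ^ 9 * Real.exp (-(γ * l)))
      Filter.atTop (nhds 0) :=
    (Real.tendsto_pow_mul_exp_neg_atTop_nhds_zero 9).comp
      (tendsto_natCast_atTop_atTop.const_mul_atTop hγ)
  have hev := hlim.eventually_le_const (u := γ ^ 9 / (192 * (C : ℝ) ^ 5)) (by positivity)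
  obtain ⟨l₁, hl₁⟩ := Filter.eventually_atTop.1 hev
  refine ⟨max l₁ 1, fun l hl => ?_⟩
  have h1 := hl₁ l (le_of_max_le_left hl)
  have hl' : (1 : ℝ) ≤ l := by exact_mod_cast le_of_max_le_right hl
  have h2 : 1 + 2 * C * (l : ℝ) ≤ 3 * C * l := by nlinarith
  have h3 : 1 + C * (l : ℝ) ^ 2 ≤ 2 * C * (l : ℝ) ^ 2 := by
    have : 1 ≤ (l : ℝ) ^ 2 := one_le_pow₀ hl'
    nlinarith
  have h4 : (l : ℝ) ^ 9 * Real.exp (-(γ * l)) ≤ 1 / (192 * (C : ℝ) ^ 5) := by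
    rw [le_div_iff₀ (by positivity)] at h1 ⊢
    have h5 : γ ^ 9 * ((l : ℝ) ^ 9 * Real.exp (-(γ * l)) * (192 * (C : ℝ) ^ 5)) ≤ γ ^ 9 * 1 := by
      rw [mul_pow] at h1
      linarith
    exact le_of_mul_le_mul_left h5 (by positivity)
  calc 4 * ((1 + 2 * C * l) * Real.exp (-(γ * l))) * (1 + C * (l : ℝ) ^ 2) ^ 4
      ≤ 4 * ((3 * C * l) * Real.exp (-(γ * l))) * (2 * C * (l : ℝ) ^ 2) ^ 4 := by gcongr
    _ = (l : ℝ) ^ 9 * Real.exp (-(γ * l)) * (192 * (C : ℝ) ^ 5) := by ring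
    _ ≤ 1 / (192 * (C : ℝ) ^ 5) * (192 * (C : ℝ) ^ 5) :=
        mul_le_mul_of_nonneg_right h4 (by positivity)
    _ = 1 := by field_simp

/-- The list sizes decrease more slowly than the degrees. -/
lemma degree_ratio_le {C : ℕ} (hC : 1 ≤ C) {e p Q : ℝ} (he0 : 0 < e) (he1 : e ≤ 1)
    (hp : p = e / (64 * C)) (hQ1 : Q ≤ 1) (hQ : 1 - p * (1 - e) ≤ Q) :
    (1 - p) * Q ^ (C - 1) + p * e / 16 + 8 * C * p ^ 2 ≤
      (1 - p * e / 2) * (Q ^ C - p * e / 16) ∧ 1 / 2 ≤ Q ^ C - p * e / 16 := by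
  have hC' : (1 : ℝ) ≤ C := by exact_mod_cast hC
  have hp0 : 0 < p := by rw [hp]; positivity
  have hCp : C * p = e / 64 := by rw [hp]; field_simp
  have hp1 : p ≤ 1 / 64 := by nlinarith
  have hQp : 1 - p ≤ Q := by nlinarith
  have hQC : 1 - C * p ≤ Q ^ C := by
    have := one_add_mul_sub_le_pow (a := Q) (by linarith) C
    nlinarith
  have hR : 1 / 2 ≤ Q ^ (C - 1) := by
    have : Q ^ C ≤ Q ^ (C - 1) := pow_le_pow_of_le_one (by linarith) hQ1 (Nat.sub_le C 1)
    linarith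
  have hpow : Q ^ C = Q ^ (C - 1) * Q := by
    rw [← pow_succ, Nat.sub_add_cancel hC]
  have hpe : p * e ≤ 1 / 64 := by nlinarith
  have hpe0 : 0 < p * e := mul_pos hp0 he0
  refine ⟨?_, by linarith⟩
  have h8 : 8 * C * p ^ 2 = p * e / 8 := by
    rw [sq, show 8 * (C : ℝ) * (p * p) = 8 * (C * p) * p by ring, hCp]
    ring
  rw [hpow, h8]
  generalize Q ^ (C - 1) = R at *
  -- The gain comes from `Q ≥ 1 - p + p * e`. Multiplied by `R ≥ 1 / 2` it is at least `p * e / 4`,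
  -- which pays for the errors `p * e / 16`, `p * e / 8` and again at most `p * e / 16`.
  have h1 : p * e / 2 ≤ (1 - p * e / 2) * Q - (1 - p) := by nlinarith
  have h2 : p * e / 4 ≤ R * ((1 - p * e / 2) * Q - (1 - p)) := by
    calc p * e / 4 = 1 / 2 * (p * e / 2) := by ring
      _ ≤ _ := mul_le_mul hR h1 (by positivity) (by linarith)
  nlinarith

namespace ColorableRatio

lemma mono {C : ℕ} {s s' : ℝ} (h : ColorableRatio.{u, v} C s) (hs : s' ≤ s) :
    ColorableRatio.{u, v} C s' := by
  obtain ⟨l₀, hl₀⟩ := h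
  exact ⟨l₀, fun l hl V ι _ I E d hE hd => hl₀ l hl V ι I E d hE
    (hd.trans (mul_le_mul_of_nonneg_right hs (Nat.cast_nonneg l)))⟩

lemma of_small {C : ℕ} (hC : 1 ≤ C) : ColorableRatio.{u, v} C (1 / (16 * C)) := by
  refine ⟨2, fun l hl V ι _ I E d hE hd => hE.colorable_of_mul_le hl ?_⟩
  have hC' : (1 : ℝ) ≤ C := by exact_mod_cast hC
  rw [one_div_mul_eq_div, le_div_iff₀ (by positivity)] at hd
  have : ((16 * (C * d) : ℕ) : ℝ) ≤ l := by
    push_cast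
    linarith
  exact_mod_cast this

-- One round multiplies the ratio by `1 - p * e / 2` with `p = e / (64 * C)`. Lists keep at least
-- half of their colors, so `l ≥ 2 * l₀ + 1` suffices for the next stage.
open Classical in
lemma step {C : ℕ} (hC : 1 ≤ C) {e s : ℝ} (he0 : 0 < e) (he1 : e ≤ 1) (hs0 : 0 < s)
    (hs : s ≤ 1 - e) (h : ColorableRatio.{u, v} C (s * (1 - e / (64 * C) * e / 2))) :
    ColorableRatio.{u, v} C s := by
  obtain ⟨l₀, hl₀⟩ := h
  have hC' : (1 : ℝ) ≤ C := by exact_mod_cast hC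
  obtain ⟨p, hp⟩ : ∃ p, p = e / (64 * C) := ⟨_, rfl⟩
  rw [← hp] at hl₀
  have hp0 : 0 < p := by rw [hp]; positivity
  have hCp : C * p = e / 64 := by rw [hp]; field_simp
  have hp1 : p ≤ 1 := by nlinarith
  obtain ⟨δ, hδ⟩ : ∃ δ, δ = p * e / 16 := ⟨_, rfl⟩
  have hδ0 : 0 < δ := by rw [hδ]; positivity
  have hδ1 : δ ≤ 1 := by nlinarith
  have hδC : δ ≤ C * p := by nlinarith
  have hs1 : s ≤ 1 := by linarith
  obtain ⟨γ, hγ⟩ : ∃ γ, γ = min ((δ * s) ^ 2 / (4 * ((C + 1) * (C + 2)))) (4 * C * p ^ 2 * s) :=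
    ⟨_, rfl⟩
  have hγ0 : 0 < γ := by
    rw [hγ]
    exact lt_min (by positivity) (by positivity)
  have hγ1 : γ * (4 * ((C + 1) * (C + 2))) ≤ (δ * s) ^ 2 := by
    rw [← le_div_iff₀ (by positivity), hγ]
    exact min_le_left _ _
  have hγ2 : γ ≤ 4 * C * p ^ 2 * s := hγ ▸ min_le_right _ _
  obtain ⟨l₁, hl₁⟩ := exists_forall_exp_le C hC hγ0
  refine ⟨max l₁ (2 * l₀ + 1), fun l hl V ι _ I E d hE hd => ?_⟩
  have hbig := hl₁ l (le_of_max_le_left hl)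
  have hl2 : 2 * l₀ + 1 ≤ l := le_of_max_le_right hl
  have hlpos : 0 < l := by omega
  have hl' : (1 : ℝ) ≤ l := by exact_mod_cast hlpos
  let _ : LinearOrder V := LinearOrder.lift' (Fintype.equivFin V) (Fintype.equivFin V).injective
  obtain ⟨ω, hω1, hω2⟩ := hE.exists_round hC hp0 hp1 hlpos hs0 hs1 hδ0 hδ1 hδC hd hγ1 hγ2 hbig
  have hq0 : 0 ≤ p / l := by positivity
  have hq1 : p / l ≤ 1 := div_le_one_of_le₀ (hp1.trans hl') (by positivity)
  have hQ1 : (1 - p / l) ^ d ≤ 1 := pow_le_one₀ (by linarith) (by linarith)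
  have hQ : 1 - p * (1 - e) ≤ (1 - p / l) ^ d := by
    have h1 := one_add_mul_le_pow (a := -(p / l)) (by linarith) d
    rw [← sub_eq_add_neg] at h1
    have h2 : (d : ℝ) * (p / l) ≤ (1 - e) * l * (p / l) :=
      mul_le_mul_of_nonneg_right (hd.trans (mul_le_mul_of_nonneg_right hs (by positivity))) hq0
    have h3 : (1 - e) * l * (p / l) = p * (1 - e) := by field_simp
    linarith
  obtain ⟨hratio, hhalf⟩ := degree_ratio_le hC he0 he1 hp hQ1 hQ
  rw [← hδ] at hratio hhalf
  rw [mul_comm C d, pow_mul] at hω1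
  rw [mul_comm (C - 1) d, pow_mul] at hω2
  generalize (1 - p / l) ^ d = Q at *
  refine colorable_of_round hE ω (l' := ⌈(Q ^ C - δ) * l⌉₊)
    (d' := ⌊s * l * ((1 - p) * Q ^ (C - 1) + δ + 8 * C * p ^ 2)⌋₊)
    (fun v => Nat.ceil_le.2 (hω1 v)) (fun a i hi => Nat.le_floor (hω2 a i hi))
    fun I' E' hE' => hl₀ _ ?_ _ _ I' E' _ hE' ?_
  · have h1 := Nat.le_ceil ((Q ^ C - δ) * (l : ℝ))
    have h2 : (2 * l₀ + 1 : ℝ) ≤ l := by exact_mod_cast hl2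
    have h3 : 1 / 2 * (l : ℝ) ≤ (Q ^ C - δ) * l := mul_le_mul_of_nonneg_right hhalf (by linarith)
    have h4 : (l₀ : ℝ) ≤ (⌈(Q ^ C - δ) * (l : ℝ)⌉₊ : ℝ) := by linarith
    exact_mod_cast h4
  · have hR : 0 ≤ Q ^ (C - 1) := pow_nonneg (by nlinarith) _
    have hpe : p * e / 2 ≤ 1 := by nlinarith
    have hnn : 0 ≤ (1 - p) * Q ^ (C - 1) + δ + 8 * C * p ^ 2 :=
      add_nonneg (add_nonneg (mul_nonneg (by linarith) hR) hδ0.le) (by positivity)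
    calc _ ≤ s * l * ((1 - p) * Q ^ (C - 1) + δ + 8 * C * p ^ 2) :=
          Nat.floor_le (mul_nonneg (by positivity) hnn)
      _ ≤ s * l * ((1 - p * e / 2) * (Q ^ C - δ)) :=
          mul_le_mul_of_nonneg_left hratio (by positivity)
      _ = s * (1 - p * e / 2) * ((Q ^ C - δ) * l) := by ring
      _ ≤ _ := mul_le_mul_of_nonneg_left (Nat.le_ceil _) (mul_nonneg hs0.le (by linarith))

/-- The slack `e = 1 - s` of the start remains valid as the ratio decreases, so every round gains
the same factor and boundedly many rounds reach `of_small`. -/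
lemma of_lt_one {C : ℕ} (hC : 1 ≤ C) {s : ℝ} (hs : s < 1) :
    ColorableRatio.{u, v} C s := by
  wlog hs0 : 0 < s
  · exact (this hC (s := 1 / 2) (by norm_num) (by norm_num)).mono (by linarith)
  have hC' : (1 : ℝ) ≤ C := by exact_mod_cast hC
  obtain ⟨e, he⟩ : ∃ e, e = 1 - s := ⟨_, rfl⟩
  have he0 : 0 < e := by linarith
  have he1 : e ≤ 1 := by linarith
  obtain ⟨θ, hθ⟩ : ∃ θ, θ = e / (64 * C) * e / 2 := ⟨_, rfl⟩
  have hθ0 : 0 < θ := by rw [hθ]; positivity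
  have hθ1 : θ < 1 := by
    have : e / (64 * C) ≤ 1 := div_le_one_of_le₀ (by linarith) (by positivity)
    nlinarith
  have key : ∀ n : ℕ, ∀ s' : ℝ, 0 < s' → s' ≤ 1 - e → s' * (1 - θ) ^ n ≤ 1 / (16 * C) →
      ColorableRatio.{u, v} C s' := by
    intro n
    induction n with
    | zero =>
      intro s' _ _ h
      exact (of_small hC).mono (by simpa using h)
    | succ n ih =>
      intro s' h0 h1 h
      refine step hC he0 he1 h0 h1 ?_
      rw [← hθ]
      refine ih _ (mul_pos h0 (by linarith)) (by nlinarith) (le_trans (le_of_eq ?_) h)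
      ring
  obtain ⟨n, hn⟩ := exists_pow_lt_of_lt_one (show (0 : ℝ) < 1 / (16 * C) by positivity)
    (show 1 - θ < 1 by linarith)
  refine key n s hs0 (by linarith) (le_trans ?_ hn.le)
  exact mul_le_of_le_one_left (pow_nonneg (by linarith) _) hs.le

end ColorableRatio

/-! ### Back to graphs and hypergraphs. -/

/-- Transfer from covers to correspondence assignments. -/
lemma IsCorrespondenceAssignment.isColorable {V α ι : Type*} {G : Gr V} {L : V → Finset α}
    {M : V → V → α → α → Prop} (hLM : IsCorrespondenceAssignment G L M) (hfin : G.verts.Finite)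
    {C l d : ℕ} (hL : ∀ v ∈ G.verts, l ≤ (L v).card) (I : V → Finset ι)
    (hI : ∀ v ∈ G.verts, (I v).card ≤ C)
    (hunique : ∀ u ∈ G.verts, ∀ v ∈ G.verts, ∀ i j, u ≠ v → i ∈ I u → i ∈ I v → j ∈ I u →
      j ∈ I v → i = j)
    (hcommon : ∀ u v, G.Adj u v → ∃ i, i ∈ I u ∧ i ∈ I v)
    (hdeg : ∀ v ∈ G.verts, ∀ c ∈ L v, ∀ i ∈ I v,
      {q | q ∈ colorNeighbors G M v c ∧ i ∈ I q.1}.ncard ≤ d)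
    (hcover : ∀ [Fintype G.verts] (I' : G.verts → Finset ι)
      (E : G.verts × Fin l → G.verts × Fin l → Prop), IsCover I' E C d → CoverColorable E) :
    IsColorable G L M := by
  have hex : ∀ v : G.verts, ∃ e : Fin l ↪ α, ∀ c, e c ∈ L v := fun v => by
    obtain ⟨s, hs, hcard⟩ := Finset.exists_subset_card_eq (hL v v.2)
    refine ⟨(s.equivFinOfCardEq hcard).symm.toEmbedding.trans (Embedding.subtype _), fun c => ?_⟩
    exact hs ((s.equivFinOfCardEq hcard).symm c).2
  choose e he using hex
  have _ : Fintype G.verts := hfin.fintype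
  have hcov : IsCover (fun v : G.verts => I v) (fun a b : G.verts × Fin l =>
      G.Adj a.1 b.1 ∧ M a.1 b.1 (e a.1 a.2) (e b.1 b.2)) C d := by
    refine ⟨fun v => hI v v.2, fun u v i j huv => hunique u u.2 v v.2 i j fun h => huv (Subtype.ext h),
      fun a b h => ⟨h.1.symm, (hLM.symm _ _ h.1 _ _).1 h.2⟩, fun a b h hab => ?_,
      fun a b h => hcommon _ _ h.1, ?_, fun a i hi => ?_⟩
    · exact G.loopless.irrefl _ (hab ▸ h.1)
    · rintro a ⟨u, c⟩ ⟨u', c'⟩ h h' huu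
      obtain rfl : u = u' := huu
      have := hLM.matching _ _ h.1 _ _ _ h.2 h'.2
      rw [show c = c' from (e u).injective this]
    · refine le_trans (Set.ncard_le_ncard_of_injOn (fun b : G.verts × Fin l => (b.1.1, e b.1 b.2))
        (fun b hb => ?_) ?_ ?_) (hdeg a.1 a.1.2 _ (he a.1 a.2) i hi)
      · exact ⟨hb.1, hb.2⟩
      · rintro ⟨u, c⟩ - ⟨u', c'⟩ - h
        simp only [Prod.mk.injEq] at h
        obtain ⟨h1, h2⟩ := h
        obtain rfl : u = u' := Subtype.ext h1
        rw [(e u).injective h2]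
      · refine (hfin.biUnion fun v _ => (L v).finite_toSet.image (Prod.mk v)).subset ?_
        rintro ⟨u, c⟩ ⟨⟨h1, h2⟩, -⟩
        simp only [Set.mem_iUnion]
        exact ⟨u, G.edge_vert h1.symm, c, (hLM.mem _ _ h1 _ _ h2).2, rfl⟩
  obtain ⟨ψ, hψ⟩ := hcover _ _ hcov
  exact ⟨fun v => e v (ψ v), fun v => he v _, fun u v huv hM => hψ u v ⟨huv, hM⟩⟩

lemma colorDegree_le_maxColorDegree {V α : Type*} {G : Gr V} (hfin : G.verts.Finite)
    (L : V → Finset α) (M : V → V → α → α → Prop) {v : V} (hv : v ∈ G.verts) {c : α}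
    (hc : c ∈ L v) : colorDegree G M v c ≤ maxColorDegree G L M := by
  refine le_csSup (Set.Finite.bddAbove ?_) ⟨v, hv, c, hc, rfl⟩
  refine (hfin.biUnion fun v _ => (L v).finite_toSet.image (colorDegree G M v)).subset ?_
  rintro _ ⟨v, hv, c, hc, rfl⟩
  simp only [Set.mem_iUnion]
  exact ⟨v, hv, c, hc, rfl⟩

/-- The coloring theorem for unions of nearly disjoint graphs. -/
theorem isColorable_iSup_of_nearlyDisjoint (C ε : ℝ) (hε : 0 < ε) :
    ∃ D₀ : ℝ, ∀ D : ℝ, D₀ ≤ D →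
      ∀ (V : Type u) (α : Type v) (m : ℕ) (G : Fin m → Gr V),
        (∀ i, (G i).verts.Finite) →
        NearlyDisjoint G →
        (∀ v ∈ ⋃ i, (G i).verts, ({i | v ∈ (G i).verts}.ncard : ℝ) ≤ C) →
        ∀ (L : V → Finset α) (M : V → V → α → α → Prop),
          IsCorrespondenceAssignment (⨆ i, G i) L M →
          (∀ i, (maxColorDegree (G i) L M : ℝ) ≤ D) →
          (∀ v ∈ (⨆ i, G i).verts, (1 + ε) * D ≤ ((L v).card : ℝ)) →
          IsColorable (⨆ i, G i) L M := by
  classical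
  have hs : 1 / (1 + ε) < 1 := by
    rw [div_lt_one (by positivity)]
    linarith
  obtain ⟨l₀, hl₀⟩ := ColorableRatio.of_lt_one.{u, 0} (Nat.le_add_left 1 ⌊C⌋₊) hs
  refine ⟨max 0 l₀, fun D hD V α m G hfin hdisj hC L M hLM hdeg hL => ?_⟩
  have hD0 : 0 ≤ D := le_of_max_le_left hD
  have hDl : (l₀ : ℝ) ≤ D := le_of_max_le_right hD
  have hl : (1 + ε) * D ≤ (⌈(1 + ε) * D⌉₊ : ℝ) := Nat.le_ceil _
  have hll : l₀ ≤ ⌈(1 + ε) * D⌉₊ := by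
    have : (l₀ : ℝ) ≤ (⌈(1 + ε) * D⌉₊ : ℝ) := by nlinarith
    exact_mod_cast this
  have hd : (⌊D⌋₊ : ℝ) ≤ 1 / (1 + ε) * (⌈(1 + ε) * D⌉₊ : ℝ) := by
    rw [one_div_mul_eq_div, le_div_iff₀ (by positivity)]
    nlinarith [Nat.floor_le hD0]
  have hunique : ∀ u v : V, ∀ i j : Fin m, u ≠ v → u ∈ (G i).verts → v ∈ (G i).verts →
      u ∈ (G j).verts → v ∈ (G j).verts → i = j := by
    intro u v i j huv h1 h2 h3 h4
    by_contra hij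
    exact huv (Set.encard_le_one_iff.1 (hdisj i j hij) u v ⟨h1, h3⟩ ⟨h2, h4⟩)
  refine hLM.isColorable (C := ⌊C⌋₊ + 1) ?_ (fun v hv => Nat.ceil_le.2 (hL v hv))
    (fun v => Finset.univ.filter fun i => v ∈ (G i).verts) (fun v hv => ?_)
    (fun u _ v _ i j huv h1 h2 h3 h4 => ?_) (fun u v huv => ?_) (fun v hv c hc i hi => ?_)
    (fun I' E hE => hl₀ _ hll _ _ I' E ⌊D⌋₊ hE hd)
  · rw [SimpleGraph.Subgraph.verts_iSup]
    exact Set.finite_iUnion hfin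
  · rw [SimpleGraph.Subgraph.verts_iSup] at hv
    have h1 := hC v hv
    rw [← Set.ncard_coe_finset]
    refine (Nat.le_floor ?_).trans (Nat.le_succ _)
    simpa using h1
  · simp only [Finset.mem_filter, Finset.mem_univ, true_and] at h1 h2 h3 h4
    exact hunique u v i j huv h1 h2 h3 h4
  · obtain ⟨i, hi⟩ := SimpleGraph.Subgraph.iSup_adj.1 huv
    exact ⟨i, by simpa using (G i).edge_vert hi, by simpa using (G i).edge_vert hi.symm⟩
  · have hi' : v ∈ (G i).verts := by simpa using hi
    -- An edge of the union with both ends in `G i` is an edge of `G i`, since no other graph of the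
    -- family contains both ends.
    have hset : {q | q ∈ colorNeighbors (⨆ i, G i) M v c ∧
        i ∈ Finset.univ.filter fun i => q.1 ∈ (G i).verts} ⊆ colorNeighbors (G i) M v c := by
      rintro ⟨u, c'⟩ ⟨⟨h1, h2⟩, h3⟩
      simp only [Finset.mem_filter, Finset.mem_univ, true_and] at h3
      obtain ⟨j, hj⟩ := SimpleGraph.Subgraph.iSup_adj.1 h1
      obtain rfl := hunique v u i j hj.ne hi' h3 ((G j).edge_vert hj) ((G j).edge_vert hj.symm)
      exact ⟨hj, h2⟩
    have hfinset : (colorNeighbors (G i) M v c).Finite := by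
      refine ((hfin i).biUnion fun v _ => (L v).finite_toSet.image (Prod.mk v)).subset ?_
      rintro ⟨u, c'⟩ ⟨h1, h2⟩
      simp only [Set.mem_iUnion]
      exact ⟨u, (G i).edge_vert h1.symm, c',
        (hLM.mem _ _ (SimpleGraph.Subgraph.iSup_adj.2 ⟨i, h1⟩) _ _ h2).2, rfl⟩
    refine (Set.ncard_le_ncard hset hfinset).trans (Nat.le_floor ?_)
    exact le_trans (Nat.cast_le.2 (colorDegree_le_maxColorDegree (hfin i) L M hi' hc)) (hdeg i)

/-- The bound on the correspondence chromatic index of linear hypergraphs with bounded edges. -/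
theorem indexDP_le_of_isLinear (k : ℕ) (ε : ℝ) (hε : 0 < ε) :
    ∃ D₀ : ℝ, ∀ D : ℝ, D₀ ≤ D →
      ∀ (W : Type u) (H : Hypergraph W),
        H.vertexSet.Finite →
        IsLinear H →
        IsBounded k H →
        (∀ x ∈ H.vertexSet, (hyperDegree H x : ℝ) ≤ D) →
        indexDP H ≤ (⌊(1 + ε) * D⌋₊ : ℕ∞) := by
  classical
  have hs : 1 / (1 + ε / 2) < 1 := by
    rw [div_lt_one (by positivity)]
    linarith
  obtain ⟨l₀, hl₀⟩ := ColorableRatio.of_lt_one.{u, u} (Nat.le_add_left 1 k) hs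
  refine ⟨max (2 / ε) l₀, fun D hD W H hfin hlin hbdd hdeg => ?_⟩
  have hDε : 2 / ε ≤ D := le_of_max_le_left hD
  have hDl : (l₀ : ℝ) ≤ D := le_of_max_le_right hD
  have hD0 : 0 ≤ D := le_trans (by positivity) hDε
  rw [div_le_iff₀ hε] at hDε
  -- Half of `ε` is spent on rounding down: `D ≥ 2 / ε` makes `ε / 2 * D` at least one.
  have hl : (1 + ε / 2) * D ≤ (⌊(1 + ε) * D⌋₊ : ℝ) := by
    have := Nat.lt_floor_add_one ((1 + ε) * D)
    nlinarith
  have hll : l₀ ≤ ⌊(1 + ε) * D⌋₊ := by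
    have : (l₀ : ℝ) ≤ (⌊(1 + ε) * D⌋₊ : ℝ) := by nlinarith
    exact_mod_cast this
  have hd : (⌊D⌋₊ : ℝ) ≤ 1 / (1 + ε / 2) * (⌊(1 + ε) * D⌋₊ : ℝ) := by
    rw [one_div_mul_eq_div, le_div_iff₀ (by positivity)]
    nlinarith [Nat.floor_le hD0]
  have hedges : H.edgeSet.Finite := hfin.finite_subsets.subset fun e he =>
    H.subset_vertexSet_of_mem_edgeSet' he
  have hefin : ∀ e ∈ H.edgeSet, e.Finite := fun e he =>
    hfin.subset (H.subset_vertexSet_of_mem_edgeSet' he)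
  -- The graphs are the cliques of edges through a common vertex, indexed by that vertex. The
  -- default `∅` never occurs for an edge of `H`.
  let I : Set W → Finset W := fun e => if he : e.Finite then he.toFinset else ∅
  have hI : ∀ {e x}, x ∈ I e → x ∈ e := by
    intro e x hx
    by_cases he : e.Finite
    · simpa [I, he] using hx
    · simp [I, he] at hx
  have hI' : ∀ {e x}, e ∈ H.edgeSet → x ∈ e → x ∈ I e := by
    intro e x he hx
    simpa [I, hefin e he] using hx
  rw [indexDP, chiDP]
  refine iInf₂_le (⌊(1 + ε) * D⌋₊) fun L M hLM hL => ?_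
  refine hLM.isColorable (C := k + 1) hedges hL I (fun e he => ?_)
    (fun e he f hf x y hef h1 h2 h3 h4 => ?_) (fun e f hef => ?_) (fun e he c hc x hx => ?_)
    (fun I' E hE => hl₀ _ hll _ _ I' E ⌊D⌋₊ hE hd)
  · have h1 := hbdd e he
    rw [(hefin e he).encard_eq_coe_toFinset_card] at h1
    simp only [I, dif_pos (hefin e he)]
    exact (Nat.cast_le.1 h1).trans (Nat.le_succ k)
  · exact Set.encard_le_one_iff.1 (hlin e he f hf hef) x y ⟨hI h1, hI h2⟩ ⟨hI h3, hI h4⟩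
  · obtain ⟨⟨he, hf, x, hx, hx'⟩, -⟩ := hef
    exact ⟨x, hI' he hx, hI' hf hx'⟩
  · have hxV : x ∈ H.vertexSet := H.subset_vertexSet_of_mem_edgeSet' he (hI hx)
    refine le_trans ?_ (Nat.le_floor (hdeg x hxV))
    refine Set.ncard_le_ncard_of_injOn Prod.fst ?_ ?_ (hedges.subset fun f hf => hf.1)
    · rintro ⟨f, c'⟩ ⟨⟨h1, -⟩, h2⟩
      exact ⟨h1.1.2.1, hI h2⟩
    · rintro ⟨f, c₁⟩ ⟨⟨h1, h2⟩, -⟩ ⟨f', c₂⟩ ⟨⟨h3, h4⟩, -⟩ hff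
      obtain rfl : f = f' := hff
      rw [show c₁ = c₂ from hLM.matching _ _ h1 _ _ _ h2 h4]

end DPColoring

theorem theorem5p2 :
    -- the coloring theorem for unions of nearly disjoint graphs
    (∀ C ε : ℝ, 0 < C → 0 < ε → ∃ D₀ : ℝ, ∀ D : ℝ, D₀ ≤ D →
      ∀ (V : Type*) (α : Type*) (m : ℕ) (G : Fin m → DPColoring.Gr V),
        (∀ i, (G i).verts.Finite) →
        DPColoring.NearlyDisjoint G →
        (∀ v ∈ ⋃ i, (G i).verts, ({i | v ∈ (G i).verts}.ncard : ℝ) ≤ C) →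
        ∀ (L : V → Finset α) (M : V → V → α → α → Prop),
          DPColoring.IsCorrespondenceAssignment (⨆ i, G i) L M →
          (∀ i, (DPColoring.maxColorDegree (G i) L M : ℝ) ≤ D) →
          (∀ v ∈ (⨆ i, G i).verts, (1 + ε) * D ≤ ((L v).card : ℝ)) →
          DPColoring.IsColorable (⨆ i, G i) L M) ∧
    -- the bound on the correspondence chromatic index of linear `k`-bounded hypergraphs
    (∀ (k : ℕ) (ε : ℝ), 0 < ε → ∃ D₀ : ℝ, ∀ D : ℝ, D₀ ≤ D →
      ∀ (W : Type*) (H : Hypergraph W),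
        H.vertexSet.Finite →
        DPColoring.IsLinear H →
        DPColoring.IsBounded k H →
        (∀ x ∈ H.vertexSet, (DPColoring.hyperDegree H x : ℝ) ≤ D) →
        DPColoring.indexDP H ≤ (⌊(1 + ε) * D⌋₊ : ℕ∞)) :=
  ⟨fun C ε _ hε => DPColoring.isColorable_iSup_of_nearlyDisjoint C ε hε,
    fun k ε hε => DPColoring.indexDP_le_of_isLinear k ε hε⟩
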